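/- Let $(\Omega,\mathcal F,\mathbb P^0)$ be a probability space carrying a one-dimensional Brownian motion $W$, let $\sigma>0$, $X_0\in\mathbb R$, $X_t=X_0+\sigma W_t$, and let $\mathbb F=(\mathcal F_t)_{t\ge 0}$ be the (right-continuous) $\mathbb P^0$-augmentation of the filtration generated by $X$. Fix $T>0$, an integer $N\ge 1$, $\gamma>1$, discount rates $r,\rho>0$, a transaction cost rate $k>0$, a maximal effort $\bar a>0$, and an increasing, strictly convex, continuously differentiable $h:[0,\infty)\to[0,\infty)$ with $h(0)=0$. Put $u(x)=x^{1/\gamma}$ and $\delta=r/\rho$. Let $\mathcal A$ be the set of $\mathbb F$-predictable processes $\alpha$ with values in $[0,\bar a]$. For $\alpha\in\mathcal A$ let $\mathbb P^\alpha$ be the probability measure equivalent to $\mathbb P^0$ under which $W_t-\int_0^t \frac{\alpha_s}{\sigma}\,ds$, $t\in[0,T]$, is an $\mathbb F$-Brownian motion. Let $\mathbb C$ be the set of contracts $\mathbf C=(\tau_1,\dots,\tau_N,\xi_1,\dots,\xi_N,\xi_T)$, where $\tau_1\le\dots\le\tau_N$ are $\mathbb F$-stopping times with values in $[0,T)$,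 each $\xi_i\ge0$ is $\mathcal F_{\tau_i}$-measurable, $\xi_T\ge 0$ is $\mathcal F_T$-measurable, and $\max_{i}\sup_{\alpha\in\mathcal A}\big(\mathbb E^{\mathbb P^\alpha}[|\xi_i|^\gamma]+\mathbb E^{\mathbb P^\alpha}[|\xi_T|^\gamma]\big)<\infty$. Let $$J^{A}(\mathbf C,\alpha)=\mathbb E^{\mathbb P^\alpha}\Big[\sum_{i=1}^N e^{-r\tau_i}u(\xi_i)+e^{-rT}u(\xi_T)-\int_0^T re^{-rt}h(\alpha_t)\,dt\Big],$$ $$J^{P}(\mathbf C,\alpha)=\mathbb E^{\mathbb P^\alpha}\Big[-\sum_{i=1}^N e^{-\rho\tau_i}(1+k)\xi_i-e^{-\rho T}\xi_T+\int_0^T\rho e^{-\rho t}\alpha_t\,dt\Big],$$ and, for $R\ge 0$, let $$V^{FB,P}=\sup\{J^P(\mathbf C,\alpha):\ \mathbf C\in\mathbb C,\ \alpha\in\mathcal A,\ J^A(\mathbf C,\alpha)\ge u(R)\}.$$ For $p\le 0$ and $\kappa\ge0$ put $G^*(p)=\sup_{a\in[0,\bar a]}(a+h(a)p)$ and $F^{*,\kappa}(p)=\inf_{y\ge0}(yp+(1+\kappa)y^\gamma)$,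 and for a function $b:(-\infty,0]\to\mathbb R$ put $$D(b)=\inf_{\lambda\le0}\Big\{\lambda u(R)+b(\lambda)-e^{-\rho T}F^{*,0}(\lambda e^{(\rho-r)T})+\int_0^T\rho e^{-\rho t}G^*(\delta\lambda e^{(\rho-r)t})\,dt\Big\}.$$ 1. If $\delta\gamma>1$, then for every $\zeta\in(0,T/N)$, with $t_i=(i-1)\zeta$, $$D\Big(\lambda\mapsto-\sum_{i=1}^N e^{-\rho t_i}F^{*,k}(\lambda e^{(\rho-r)t_i})\Big)\le V^{FB,P}\le D\big(\lambda\mapsto -N F^{*,k}(\lambda)\big).$$ 2. If $\delta\gamma<1$, then for every $\zeta\in(0,T/N)$, with $t_i=T-i\zeta$, $$D\Big(\lambda\mapsto-\sum_{i=1}^N e^{-\rho t_i}F^{*,k}(\lambda e^{(\rho-r)t_i})\Big)\le V^{FB,P}\le D\big(\lambda\mapsto -N e^{-\rho T}F^{*,k}(\lambda e^{(\rho-r)T})\big).$$ 3. If $\delta\gamma=1$, then $$V^{FB,P}=D\big(\lambda\mapsto -N e^{-\rho T}F^{*,k}(\lambda e^{(\rho-r)T})\big).$$ 4. If $R=0$,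 then $0<V^{FB,P}<\bar a\,(1-e^{-\rho T})$. -/

import Mathlib

open MeasureTheory ProbabilityTheory Set
open scoped NNReal ENNReal

/-- The primitives of the principal-agent model: a probability space `(Ω, 𝓐, P)` carrying a
one-dimensional Brownian motion `W`, and the parameters with their standing assumptions. -/
structure PAModel (Ω : Type*) [MeasurableSpace Ω] where
  /-- reference measure -/
  P : Measure Ω
  isProb : IsProbabilityMeasure P
  /-- driving Brownian motion -/
  W : ℝ≥0 → Ω → ℝ
  measurable_W : ∀ t, Measurable (W t)
  brownian_W : IsBrownianReal W P
  /-- initial output -/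
  X₀ : ℝ
  /-- volatility -/
  σ : ℝ
  σ_pos : 0 < σ
  /-- horizon -/
  T : ℝ≥0
  T_pos : 0 < T
  /-- number of bonus payments -/
  N : ℕ
  one_le_N : 1 ≤ N
  /-- utility exponent: `u x = x ^ (1 / γ)` -/
  γ : ℝ
  one_lt_γ : 1 < γ
  /-- the agent's discount rate -/
  r : ℝ
  r_pos : 0 < r
  /-- the principal's discount rate -/
  ρ : ℝ
  ρ_pos : 0 < ρ
  /-- transaction cost rate of a bonus payment -/
  k : ℝ
  k_pos : 0 < k
  /-- maximal effort -/
  abar : ℝ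
  abar_pos : 0 < abar
  /-- cost of effort, used only on `[0, ∞)` -/
  h : ℝ → ℝ
  h_mono : MonotoneOn h (Ici 0)
  h_strictConvex : StrictConvexOn ℝ (Ici 0) h
  h_contDiff : ContDiffOn ℝ 1 h (Ici 0)
  h_zero : h 0 = 0

/-- The augmentation of a filtration by the `P`-null events, made right-continuous. -/
noncomputable def augmentation {Ω : Type*} [m : MeasurableSpace Ω]
    (𝓖 : Filtration ℝ≥0 m) (P : Measure Ω) : Filtration ℝ≥0 m :=
  Filtration.rightCont
    { seq := fun t => 𝓖 t ⊔ MeasurableSpace.generateFrom {A | MeasurableSet A ∧ P A = 0}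
      mono' := fun _ _ hst => sup_le_sup_right (𝓖.mono hst) _
      le' := fun t => sup_le (𝓖.le t) (MeasurableSpace.generateFrom_le fun _ hA => hA.1) }

/-- `B` is, on `[0, T]`, a standard one-dimensional Brownian motion with respect to the
filtration `𝓕` under the measure `Q`. -/
structure IsBrownianOn {Ω : Type*} [m : MeasurableSpace Ω] (𝓕 : Filtration ℝ≥0 m)
    (Q : Measure Ω) (T : ℝ≥0) (B : ℝ≥0 → Ω → ℝ) : Prop where
  adapted : ∀ t ≤ T, Measurable[𝓕 t] (B t)
  zero : ∀ᵐ ω ∂Q, B 0 ω = 0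
  cont : ∀ᵐ ω ∂Q, ContinuousOn (fun t => B t ω) (Icc 0 T)
  indep : ∀ s t, s ≤ t → t ≤ T →
    Indep (MeasurableSpace.comap (fun ω => B t ω - B s ω) inferInstance) (𝓕 s) Q
  law : ∀ s t, s ≤ t → t ≤ T →
    HasLaw (fun ω => B t ω - B s ω) (gaussianReal 0 (t - s)) Q

/-- The data of a contract: `N` bonus times, `N` bonus payments and a terminal payment. -/
structure Contract (N : ℕ) (Ω : Type*) where
  τ : Fin N → Ω → ℝ≥0
  ξ : Fin N → Ω → ℝ
  ξT : Ω → ℝ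

namespace PAModel

variable {Ω : Type*} [m : MeasurableSpace Ω] (M : PAModel Ω)

/-- Relative discounting. -/
noncomputable def δ : ℝ := M.r / M.ρ

/-- The agent's utility function. -/
noncomputable def u (x : ℝ) : ℝ := x ^ (1 / M.γ)

/-- The output process `X = X₀ + σ W`. -/
def X (t : ℝ≥0) (ω : Ω) : ℝ := M.X₀ + M.σ * M.W t ω

lemma measurable_X (t : ℝ≥0) : Measurable (M.X t) :=
  ((M.measurable_W t).const_mul M.σ).const_add M.X₀

/-- The augmented filtration generated by the output. -/
noncomputable def 𝓕 : Filtration ℝ≥0 m :=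
  augmentation (Filtration.natural M.X fun t => (M.measurable_X t).stronglyMeasurable) M.P

/-- Effort processes: predictable processes with values in `[0, abar]`. -/
def Effort (α : ℝ≥0 → Ω → ℝ) : Prop :=
  IsStronglyPredictable M.𝓕 α ∧ ∀ t ω, α t ω ∈ Icc 0 M.abar

/-- `W^α = W - ∫ α / σ`. -/
noncomputable def Wα (α : ℝ≥0 → Ω → ℝ) (t : ℝ≥0) (ω : Ω) : ℝ :=
  M.W t ω - ∫ s in (0 : ℝ)..t, α s.toNNReal ω / M.σ

/-- `Q` is the measure `ℙ^α` induced by the effort `α`: it is equivalent to the reference measure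
and `W^α` is a Brownian motion under `Q`. (This determines `Q` on `𝓕 T`.) -/
structure IsEffortMeasure (α : ℝ≥0 → Ω → ℝ) (Q : Measure Ω) : Prop where
  isProb : IsProbabilityMeasure Q
  ac : Q ≪ M.P
  ac' : M.P ≪ Q
  brownian : IsBrownianOn M.𝓕 Q M.T (M.Wα α)

/-- Admissible contracts. -/
structure Admissible (C : Contract M.N Ω) : Prop where
  stopping : ∀ i, IsStoppingTime M.𝓕 (fun ω => (C.τ i ω : WithTop ℝ≥0))
  lt_T : ∀ i ω, C.τ i ω < M.T
  increasing : ∀ ω, Monotone fun i => C.τ i ω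
  ξ_nonneg : ∀ i ω, 0 ≤ C.ξ i ω
  ξ_meas : ∀ i, Measurable[(stopping i).measurableSpace] (C.ξ i)
  ξT_nonneg : ∀ ω, 0 ≤ C.ξT ω
  ξT_meas : Measurable[M.𝓕 M.T] C.ξT
  integrability :
    (⨆ (i : Fin M.N) (α : ℝ≥0 → Ω → ℝ) (Q : Measure Ω)
        (_ : M.Effort α) (_ : M.IsEffortMeasure α Q),
      ((∫⁻ ω, ENNReal.ofReal (|C.ξ i ω| ^ M.γ) ∂Q) +
        ∫⁻ ω, ENNReal.ofReal (|C.ξT ω| ^ M.γ) ∂Q)) < ∞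

/-- The agent's objective `J^A(C, α)`, the expectation being taken under `Q = ℙ^α`. -/
noncomputable def JA (C : Contract M.N Ω) (α : ℝ≥0 → Ω → ℝ) (Q : Measure Ω) : ℝ :=
  ∫ ω, ((∑ i, Real.exp (-M.r * C.τ i ω) * M.u (C.ξ i ω))
    + Real.exp (-M.r * M.T) * M.u (C.ξT ω)
    - ∫ t in (0 : ℝ)..M.T, M.r * Real.exp (-M.r * t) * M.h (α t.toNNReal ω)) ∂Q

/-- The principal's objective `J^P(C, α)`, the expectation being taken under `Q = ℙ^α`. -/
noncomputable def JP (C : Contract M.N Ω) (α : ℝ≥0 → Ω → ℝ) (Q : Measure Ω) : ℝ :=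
  ∫ ω, (-(∑ i, Real.exp (-M.ρ * C.τ i ω) * ((1 + M.k) * C.ξ i ω))
    - Real.exp (-M.ρ * M.T) * C.ξT ω
    + ∫ t in (0 : ℝ)..M.T, M.ρ * Real.exp (-M.ρ * t) * α t.toNNReal ω) ∂Q

/-- The principal's first-best value at reservation level `R`. -/
noncomputable def VFB (R : ℝ) : EReal :=
  sSup {v : EReal | ∃ (C : Contract M.N Ω) (α : ℝ≥0 → Ω → ℝ) (Q : Measure Ω),
    M.Admissible C ∧ M.Effort α ∧ M.IsEffortMeasure α Q ∧ M.u R ≤ M.JA C α Q ∧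
    v = (M.JP C α Q : EReal)}

/-- `F y = - u⁻¹ y = - y ^ γ`. -/
noncomputable def F (y : ℝ) : ℝ := -y ^ M.γ

/-- The concave conjugate `F^{*,κ}`. -/
noncomputable def Fstar (κ p : ℝ) : ℝ :=
  sInf ((fun y => y * p - (1 + κ) * M.F y) '' Ici 0)

/-- The convex dual `G^*` of the cost of effort. -/
noncomputable def Gstar (p : ℝ) : ℝ :=
  sSup ((fun a => a + M.h a * p) '' Icc 0 M.abar)

/-- `inf_{l ≤ 0} { l u(R) + b(l) - e^{-ρT} F^{*,0}(l e^{(ρ-r)T})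
  + ∫_0^T ρ e^{-ρt} G^*(δ l e^{(ρ-r)t}) dt }`, where `b(l)` is the contribution of the bonuses. -/
noncomputable def dualInf (R : ℝ) (b : ℝ → ℝ) : EReal :=
  ⨅ (l : ℝ) (_ : l ≤ 0),
    ((l * M.u R + b l
      - Real.exp (-M.ρ * M.T) * M.Fstar 0 (l * Real.exp ((M.ρ - M.r) * M.T))
      + ∫ t in (0 : ℝ)..M.T, M.ρ * Real.exp (-M.ρ * t) *
          M.Gstar (M.δ * l * Real.exp ((M.ρ - M.r) * t)) : ℝ) : EReal)

/-- The bonus contribution `- e^{-ρs} F^{*,k}(l e^{(ρ-r)s})` of one payment at time `s`. -/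
noncomputable def bonus (s l : ℝ) : ℝ :=
  -(Real.exp (-M.ρ * s) * M.Fstar M.k (l * Real.exp ((M.ρ - M.r) * s)))

end PAModel

/-! *Upper bounds.* Weak duality holds outcome by outcome. For a multiplier `l ≤ 0` on the
participation constraint, a payment at time `s` contributes at most
`-e^{-ρs} F^{*,κ}(l e^{(ρ-r)s})` to the Lagrangian, and effort at time `t` at most
`ρ e^{-ρt} G^*(δ l e^{(ρ-r)t})`. As `F^{*,κ}` is a power function, the former is a constant times
`e^{cs}`, where `c` has the sign of `1 - δγ`. Bonuses are therefore best paid at time `0` if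
`δγ ≥ 1` and at time `T` if `δγ ≤ 1`.

*Lower bounds.* For fixed payment times, the maximizers of the Lagrangian form a deterministic plan
that depends continuously on `l`. By the intermediate value theorem the participation constraint
binds at some `l`, so there is no duality gap. The continuous effort of the plan is replaced by step
functions, for which `ℙ^α` results from iterating Girsanov's theorem for a drift that is constant
from some time on, and the terminal payment compensates the agent for the error.

*The case `R = 0`.* A small constant effort `a` is profitable because the payment that compensates
for its cost is of order `a^γ` with `γ > 1`. Conversely, at a small multiplier `l` the dual
function falls short of `ā (1 - e^{-ρT})` at first order in `l`, whereas the payments contribute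
only `O((-l)^{γ/(γ-1)})`. -/

/-! ### Brownian increments -/

lemma indep_and_hasLaw_of_charFun_restrict {Ω E : Type*} {𝓖 : MeasurableSpace Ω}
    [MeasurableSpace Ω] [NormedAddCommGroup E] [InnerProductSpace ℝ E] [CompleteSpace E]
    [SecondCountableTopology E] [MeasurableSpace E] [BorelSpace E]
    {Q : Measure Ω} [IsProbabilityMeasure Q] {μ : Measure E} [IsFiniteMeasure μ]
    {X : Ω → E} (hX : Measurable X)
    (h : ∀ A, MeasurableSet[𝓖] A → ∀ θ,
      charFun ((Q.restrict A).map X) θ = Q.real A * charFun μ θ) :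
    Indep (MeasurableSpace.comap X inferInstance) 𝓖 Q ∧ HasLaw X μ Q := by
  have map_restrict (A) (hA : MeasurableSet[𝓖] A) : (Q.restrict A).map X = Q A • μ := by
    have : IsFiniteMeasure (Q A • μ) := μ.smul_finite (measure_ne_top Q A)
    refine Measure.ext_of_charFun (funext fun θ => ?_)
    simp [h A hA θ, charFun_apply, integral_smul_measure, Measure.real]
  have map_eq : Q.map X = μ := by simpa using map_restrict univ MeasurableSet.univ
  refine ⟨?_, hX.aemeasurable, map_eq⟩
  rw [Indep_iff]
  rintro _ A ⟨S, hS, rfl⟩ hA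
  have := congrArg (· S) (map_restrict A hA)
  simp only [Measure.smul_apply, smul_eq_mul] at this
  rwa [Measure.map_apply hX hS, Measure.restrict_apply (hX hS), ← map_eq,
    Measure.map_apply hX hS, mul_comm] at this

lemma augmentation_le_of_lt {Ω : Type*} [m : MeasurableSpace Ω]
    (𝓖 : Filtration ℝ≥0 m) (P : Measure Ω) {s t : ℝ≥0} (hst : s < t) :
    augmentation 𝓖 P s
      ≤ 𝓖 t ⊔ MeasurableSpace.generateFrom {A | MeasurableSet A ∧ P A = 0} := by
  rw [augmentation, Filtration.rightCont_eq]
  exact iInf₂_le t hst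

lemma le_augmentation {Ω : Type*} [m : MeasurableSpace Ω] (𝓖 : Filtration ℝ≥0 m) (P : Measure Ω) :
    𝓖 ≤ augmentation 𝓖 P :=
  fun t => by
    rw [augmentation, Filtration.rightCont_eq]
    exact le_iInf₂ fun s hts => (𝓖.mono hts.le).trans le_sup_left

lemma exists_ae_eq_of_measurableSet_sup_null {Ω : Type*} {𝓖 : MeasurableSpace Ω} [MeasurableSpace Ω]
    {P : Measure Ω} {A : Set Ω}
    (hA : MeasurableSet[𝓖 ⊔ MeasurableSpace.generateFrom {A | MeasurableSet A ∧ P A = 0}] A) :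
    ∃ A', MeasurableSet[𝓖] A' ∧ A =ᵐ[P] A' := by
  have hle : 𝓖 ⊔ MeasurableSpace.generateFrom {A | MeasurableSet A ∧ P A = 0}
      ≤ eventuallyMeasurableSpace 𝓖 (ae P) :=
    sup_le le_eventuallyMeasurableSpace <| MeasurableSpace.generateFrom_le
      fun _ hB => ⟨∅, @MeasurableSet.empty _ 𝓖, ae_eq_empty.2 hB.2⟩
  exact hle A hA

namespace IsBrownianOn

variable {Ω : Type*} [m : MeasurableSpace Ω] {𝓕 : Filtration ℝ≥0 m} {Q : Measure Ω} {T : ℝ≥0}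
  {B : ℝ≥0 → Ω → ℝ}

lemma measurable (hB : IsBrownianOn 𝓕 Q T B) {t : ℝ≥0} (ht : t ≤ T) : Measurable (B t) :=
  (hB.adapted t ht).mono (𝓕.le t) le_rfl

lemma integral_mul_cexp (hB : IsBrownianOn 𝓕 Q T B) {s t : ℝ≥0} (hst : s ≤ t) (ht : t ≤ T)
    {f : Ω → ℂ} (hf : Measurable[𝓕 s] f) (z : ℂ) :
    ∫ ω, f ω * Complex.exp (z * (B t ω - B s ω : ℝ)) ∂Q
      = (∫ ω, f ω ∂Q) * Complex.exp ((t - s : ℝ) * z ^ 2 / 2) := by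
  have hmeas : Measurable fun ω => B t ω - B s ω :=
    (hB.measurable ht).sub (hB.measurable (hst.trans ht))
  have hind : IndepFun f (fun ω => Complex.exp (z * (B t ω - B s ω : ℝ))) Q := by
    refine indep_of_indep_of_le_left (indep_of_indep_of_le_right (hB.indep s t hst ht).symm ?_)
      hf.comap_le
    have hexp : Measurable fun x : ℝ => Complex.exp (z * x) := by fun_prop
    exact (hexp.comp (comap_measurable _)).comap_le
  have hmgf := complexMGF_gaussianReal (hB.law s t hst ht).map_eq z
  rw [complexMGF] at hmgf
  rw [hind.integral_fun_mul_eq_mul_integral (hf.mono (𝓕.le s) le_rfl).aestronglyMeasurable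
    (Measurable.aestronglyMeasurable (by fun_prop)), hmgf]
  simp [NNReal.coe_sub hst]

lemma setIntegral_cexp (hB : IsBrownianOn 𝓕 Q T B) {s t : ℝ≥0} (hst : s ≤ t) (ht : t ≤ T)
    {A : Set Ω} (hA : MeasurableSet[𝓕 s] A) (θ : ℝ) :
    ∫ ω in A, Complex.exp (θ * Complex.I * (B t ω - B s ω : ℝ)) ∂Q
      = Q.real A * Complex.exp (-((t - s : ℝ) * θ ^ 2 / 2)) := by
  have h := hB.integral_mul_cexp hst ht
    ((measurable_const (a := (1 : ℂ))).indicator hA) (θ * Complex.I)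
  rw [integral_indicator_const _ (𝓕.le s _ hA), mul_pow, Complex.I_sq] at h
  rw [← integral_indicator (𝓕.le s _ hA)]
  simpa [indicator, neg_div] using h

lemma of_setIntegral_cexp [IsProbabilityMeasure Q] (adapted : ∀ t ≤ T, Measurable[𝓕 t] (B t))
    (zero : ∀ᵐ ω ∂Q, B 0 ω = 0) (cont : ∀ᵐ ω ∂Q, ContinuousOn (fun t => B t ω) (Icc 0 T))
    (h : ∀ s t, s ≤ t → t ≤ T → ∀ A, MeasurableSet[𝓕 s] A → ∀ θ : ℝ,
      ∫ ω in A, Complex.exp (θ * Complex.I * (B t ω - B s ω : ℝ)) ∂Q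
        = Q.real A * Complex.exp (-((t - s : ℝ) * θ ^ 2 / 2))) :
    IsBrownianOn 𝓕 Q T B := by
  have hmeas {t : ℝ≥0} (ht : t ≤ T) : Measurable (B t) := (adapted t ht).mono (𝓕.le t) le_rfl
  have key (s t : ℝ≥0) (hst : s ≤ t) (ht : t ≤ T) :
      Indep (MeasurableSpace.comap (fun ω => B t ω - B s ω) inferInstance) (𝓕 s) Q ∧
        HasLaw (fun ω => B t ω - B s ω) (gaussianReal 0 (t - s)) Q := by
    have hinc : Measurable fun ω => B t ω - B s ω := (hmeas ht).sub (hmeas (hst.trans ht))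
    refine indep_and_hasLaw_of_charFun_restrict hinc fun A hA θ => ?_
    rw [charFun_apply_real, integral_map hinc.aemeasurable (by fun_prop), charFun_gaussianReal]
    simpa [mul_right_comm, NNReal.coe_sub hst] using h s t hst ht A hA θ
  exact ⟨adapted, zero, cont, fun s t hst ht => (key s t hst ht).1,
    fun s t hst ht => (key s t hst ht).2⟩

/-- The identity for the augmentation at time `s` is the right limit of the one for `𝓖` at times
`s + ε`. -/
lemma augmentation_of_lt {𝓖 : Filtration ℝ≥0 m} [IsProbabilityMeasure Q] {T' : ℝ≥0}
    (hB : IsBrownianOn 𝓖 Q T' B) (hT : T < T') : IsBrownianOn (augmentation 𝓖 Q) Q T B := by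
  have tendsto_right {s : ℝ≥0} (hs : s ≤ T) :
      Filter.Tendsto (s + ·) (nhdsWithin 0 (Ioi 0)) (nhdsWithin s (Icc 0 T')) := by
    have hcont : Filter.Tendsto (s + ·) (nhdsWithin 0 (Ioi 0)) (nhds s) :=
      ((continuous_const_add s).tendsto' 0 s (add_zero s)).mono_left nhdsWithin_le_nhds
    refine tendsto_nhdsWithin_iff.2 ⟨hcont, ?_⟩
    filter_upwards [hcont.eventually_le_const (hs.trans_lt hT)] with ε hε
    exact ⟨zero_le, hε⟩
  refine of_setIntegral_cexp
    (fun t ht => (hB.adapted t (ht.trans hT.le)).mono (le_augmentation 𝓖 Q t) le_rfl) hB.zero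
    (hB.cont.mono fun ω hω => hω.mono (Icc_subset_Icc_right hT.le)) fun s t hst ht A hA θ => ?_
  have hlim : Filter.Tendsto
      (fun ε => ∫ ω in A, Complex.exp (θ * Complex.I * (B (t + ε) ω - B (s + ε) ω : ℝ)) ∂Q)
      (nhdsWithin 0 (Ioi 0))
      (nhds (∫ ω in A, Complex.exp (θ * Complex.I * (B t ω - B s ω : ℝ)) ∂Q)) := by
    refine tendsto_integral_filter_of_dominated_convergence (fun _ => 1) ?_ ?_ (by simp) ?_
    · filter_upwards [tendsto_nhdsWithin_iff.1 (tendsto_right ht) |>.2] with ε hε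
      have ht' := hB.measurable hε.2
      have hs' := hB.measurable ((add_le_add_left hst ε).trans hε.2)
      fun_prop
    · filter_upwards with ε
      filter_upwards with ω
      rw [mul_right_comm, ← Complex.ofReal_mul, Complex.norm_exp_ofReal_mul_I]
    · filter_upwards [ae_restrict_of_ae hB.cont] with ω hω
      have hexp : Continuous fun x : ℝ => Complex.exp (θ * Complex.I * x) := by fun_prop
      have hpath {s : ℝ≥0} (hs : s ≤ T) := (hω s ⟨zero_le, hs.trans hT.le⟩).tendsto.comp
        (tendsto_right hs)
      exact (hexp.tendsto _).comp ((hpath ht).sub (hpath (hst.trans ht)))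
  refine tendsto_nhds_unique hlim (tendsto_const_nhds.congr' ?_)
  filter_upwards [tendsto_nhdsWithin_iff.1 (tendsto_right ht) |>.2, self_mem_nhdsWithin]
    with ε hε hpos
  obtain ⟨A', hA', hAA'⟩ := exists_ae_eq_of_measurableSet_sup_null
    (augmentation_le_of_lt 𝓖 Q (lt_add_of_pos_right s hpos) A hA)
  rw [setIntegral_congr_set hAA', measureReal_congr hAA',
    hB.setIntegral_cexp (add_le_add_left hst ε) hε.2 hA']
  simp

end IsBrownianOn

namespace PAModel

variable {Ω : Type*} [m : MeasurableSpace Ω] (M : PAModel Ω)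

lemma indep_increment_W {s t : ℝ≥0} (hst : s ≤ t) :
    Indep (MeasurableSpace.comap (fun ω => M.W t ω - M.W s ω) inferInstance)
      (MeasurableSpace.comap (fun ω (j : Iic s) => M.W j ω) inferInstance) M.P := by
  have h := (IndepFun_iff_Indep _ _ _).1 (M.brownian_W.indepFun_shift s)
  refine indep_of_indep_of_le_left h ?_
  have heq : (fun ω => M.W t ω - M.W s ω)
      = (fun f : ℝ≥0 → ℝ => f (t - s)) ∘ fun ω u => M.W (s + u) ω - M.W s ω := by
    ext ω
    simp [add_tsub_cancel_of_le hst]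
  rw [heq]
  have heval : Measurable fun f : ℝ≥0 → ℝ => f (t - s) := measurable_pi_apply _
  exact (heval.comp (comap_measurable _)).comap_le

lemma hasLaw_increment_W {s t : ℝ≥0} (hst : s ≤ t) :
    HasLaw (fun ω => M.W t ω - M.W s ω) (gaussianReal 0 (t - s)) M.P := by
  have h : nndist (t : ℝ) s = t - s := by
    ext
    rw [coe_nndist, NNReal.coe_sub hst]
    exact abs_of_nonneg (sub_nonneg.2 hst)
  exact h ▸ M.brownian_W.hasLaw_sub t s

lemma isBrownianOn_natural (T : ℝ≥0) :
    IsBrownianOn (Filtration.natural M.X fun t => (M.measurable_X t).stronglyMeasurable)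
      M.P T M.W where
  adapted t _ := by
    have hW : M.W t = fun ω => (M.X t ω - M.X₀) / M.σ := by
      ext ω
      simp [X, M.σ_pos.ne']
    rw [hW]
    exact ((Filtration.stronglyAdapted_natural
      (fun t => (M.measurable_X t).stronglyMeasurable) t).measurable.sub_const _).div_const _
  zero := M.brownian_W.eval_zero_ae_eq_zero
  cont := M.brownian_W.cont.mono fun _ hω => hω.continuousOn
  indep s t hst _ := by
    refine indep_of_indep_of_le_right (M.indep_increment_W hst) (iSup₂_le fun j hj => ?_)
    have hX : Measurable fun f : Iic s → ℝ => M.X₀ + M.σ * f ⟨j, hj⟩ := by fun_prop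
    exact (hX.comp (comap_measurable fun ω (j : Iic s) => M.W j ω)).comap_le
  law _ _ hst _ := M.hasLaw_increment_W hst

lemma isBrownianOn_W (T : ℝ≥0) : IsBrownianOn M.𝓕 M.P T M.W :=
  have := M.isProb
  (M.isBrownianOn_natural (T + 1)).augmentation_of_lt (lt_add_one T)

end PAModel

/-! ### Girsanov's theorem for step drifts -/

namespace IsBrownianOn

/-- The density on `𝓕 t` of the change of measure that adds the drift `a` to `B` from time `u`
on. It equals `1` for `t ≤ u`, through the maximum and the truncated subtraction. -/
noncomputable def driftDensity {Ω : Type*} (B : ℝ≥0 → Ω → ℝ) (a : ℝ) (u t : ℝ≥0) (ω : Ω) : ℝ :=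
  Real.exp (a * (B (max t u) ω - B u ω) - (t - u : ℝ≥0) * a ^ 2 / 2)

lemma driftDensity_pos {Ω : Type*} (B : ℝ≥0 → Ω → ℝ) (a : ℝ) (u t : ℝ≥0) (ω : Ω) :
    0 < driftDensity B a u t ω :=
  Real.exp_pos _

@[simp]
lemma driftDensity_zero {Ω : Type*} (B : ℝ≥0 → Ω → ℝ) (a : ℝ) (u : ℝ≥0) (ω : Ω) :
    driftDensity B a u 0 ω = 1 := by
  simp [driftDensity]

lemma exists_driftDensity_eq_mul {Ω : Type*} (B : ℝ≥0 → Ω → ℝ) (a : ℝ) {u s t : ℝ≥0}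
    (hst : s ≤ t) (hu : t ≤ u ∨ u ≤ s) :
    ∃ c : ℝ, a * (t - u : ℝ≥0) - a * (s - u : ℝ≥0) = c * (t - s) ∧
      ∀ ω, driftDensity B a u t ω
        = driftDensity B a u s ω * Real.exp (c * (B t ω - B s ω) - (t - s) * c ^ 2 / 2) := by
  obtain htu | hus := hu
  · have hsu := hst.trans htu
    exact ⟨0, by simp [tsub_eq_zero_of_le, htu, hsu],
      fun ω => by simp [driftDensity, tsub_eq_zero_of_le, htu, hsu]⟩
  · have hut := hus.trans hst
    refine ⟨a, by rw [NNReal.coe_sub hut, NNReal.coe_sub hus]; ring, fun ω => ?_⟩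
    rw [driftDensity, driftDensity, ← Real.exp_add, max_eq_left hut, max_eq_left hus,
      NNReal.coe_sub hut, NNReal.coe_sub hus]
    ring_nf

variable {Ω : Type*} [m : MeasurableSpace Ω] {𝓕 : Filtration ℝ≥0 m} {Q : Measure Ω} {T : ℝ≥0}
  {B : ℝ≥0 → Ω → ℝ}

lemma measurable_driftDensity (hB : IsBrownianOn 𝓕 Q T B) (a : ℝ) {u t : ℝ≥0} (hu : u ≤ T)
    (ht : t ≤ T) : Measurable[𝓕 t] (driftDensity B a u t) := by
  obtain hut | htu := le_total u t
  · have hBt := hB.adapted t ht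
    have hBu := (hB.adapted u hu).mono (𝓕.mono hut) le_rfl
    have heq : driftDensity B a u t
        = fun ω => Real.exp (a * (B t ω - B u ω) - (t - u : ℝ≥0) * a ^ 2 / 2) := by
      ext ω
      rw [driftDensity, max_eq_left hut]
    rw [heq]
    exact Real.measurable_exp.comp (((hBt.sub hBu).const_mul a).sub_const _)
  · have heq : driftDensity B a u t = fun _ => 1 := by
      ext ω
      simp [driftDensity, tsub_eq_zero_of_le, htu]
    rw [heq]
    exact measurable_const

/-- The increment from `s` to `t` of `B` with the drift removed, in exponential form. -/
noncomputable def incrementCexp {Ω : Type*} (B : ℝ≥0 → Ω → ℝ) (a : ℝ) (u : ℝ≥0) (θ : ℝ)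
    (s t : ℝ≥0) (ω : Ω) : ℂ :=
  Complex.exp (θ * Complex.I *
    ((B t ω - a * (t - u : ℝ≥0)) - (B s ω - a * (s - u : ℝ≥0)) : ℝ))

lemma integral_mul_incrementCexp_of_le_or_le (hB : IsBrownianOn 𝓕 Q T B) (a : ℝ) {u s t : ℝ≥0}
    (hu : u ≤ T) (hst : s ≤ t) (ht : t ≤ T) (hust : t ≤ u ∨ u ≤ s) {f : Ω → ℂ}
    (hf : Measurable[𝓕 s] f) (θ : ℝ) :
    ∫ ω, f ω * driftDensity B a u t ω * incrementCexp B a u θ s t ω ∂Q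
      = (∫ ω, f ω * driftDensity B a u s ω ∂Q) * Complex.exp (-((t - s : ℝ) * θ ^ 2 / 2)) := by
  obtain ⟨c, hc, hdensity⟩ := exists_driftDensity_eq_mul B a hst hust
  have factor (ω) : f ω * driftDensity B a u t ω * incrementCexp B a u θ s t ω
      = f ω * driftDensity B a u s ω * Complex.exp ((c + θ * Complex.I) * (B t ω - B s ω : ℝ))
        * Complex.exp (-(t - s : ℝ) * c ^ 2 / 2 - θ * Complex.I * (c * (t - s : ℝ))) := by
    have hinc : B t ω - a * (t - u : ℝ≥0) - (B s ω - a * (s - u : ℝ≥0))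
        = B t ω - B s ω - c * (t - s) := by rw [← hc]; ring
    rw [hdensity, incrementCexp, hinc, Complex.ofReal_mul, Complex.ofReal_exp, ← mul_assoc,
      mul_assoc (_ * _), mul_assoc (_ * _), ← Complex.exp_add, ← Complex.exp_add]
    congr 2
    push_cast
    ring
  have hfZ : Measurable[𝓕 s] fun ω => f ω * driftDensity B a u s ω :=
    hf.mul (Complex.measurable_ofReal.comp (hB.measurable_driftDensity a hu (hst.trans ht)))
  simp_rw [factor]
  rw [integral_mul_const, hB.integral_mul_cexp hst ht hfZ, mul_assoc, ← Complex.exp_add]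
  congr 2
  push_cast
  linear_combination (t - s : ℂ) * θ ^ 2 / 2 * Complex.I_sq

lemma measurable_incrementCexp (hB : IsBrownianOn 𝓕 Q T B) (a : ℝ) (u : ℝ≥0) (θ : ℝ) {s t : ℝ≥0}
    (hst : s ≤ t) (ht : t ≤ T) : Measurable[𝓕 t] (incrementCexp B a u θ s t) := by
  have hBt := hB.adapted t ht
  have hBs := (hB.adapted s (hst.trans ht)).mono (𝓕.mono hst) le_rfl
  exact Complex.measurable_exp.comp ((Complex.measurable_ofReal.comp
    ((hBt.sub_const _).sub (hBs.sub_const _))).const_mul _)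

lemma integral_mul_incrementCexp (hB : IsBrownianOn 𝓕 Q T B) (a : ℝ) {u s t : ℝ≥0}
    (hu : u ≤ T) (hst : s ≤ t) (ht : t ≤ T) {f : Ω → ℂ} (hf : Measurable[𝓕 s] f) (θ : ℝ) :
    ∫ ω, f ω * driftDensity B a u t ω * incrementCexp B a u θ s t ω ∂Q
      = (∫ ω, f ω * driftDensity B a u s ω ∂Q) * Complex.exp (-((t - s : ℝ) * θ ^ 2 / 2)) := by
  by_cases hust : t ≤ u ∨ u ≤ s
  · exact hB.integral_mul_incrementCexp_of_le_or_le a hu hst ht hust hf θ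
  have hut : u ≤ t := (not_le.1 fun h => hust (.inl h)).le
  have hsu : s ≤ u := (not_le.1 fun h => hust (.inr h)).le
  have split (ω) : f ω * driftDensity B a u t ω * incrementCexp B a u θ s t ω
      = f ω * incrementCexp B a u θ s u ω * driftDensity B a u t ω
        * incrementCexp B a u θ u t ω := by
    have : incrementCexp B a u θ s t ω
        = incrementCexp B a u θ s u ω * incrementCexp B a u θ u t ω := by
      rw [incrementCexp, incrementCexp, incrementCexp, ← Complex.exp_add]
      push_cast
      ring_nf
    rw [this]
    ring
  have hfu : Measurable[𝓕 u] fun ω => f ω * incrementCexp B a u θ s u ω :=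
    (hf.mono (𝓕.mono hsu) le_rfl).mul (hB.measurable_incrementCexp a u θ hsu hu)
  simp_rw [split]
  rw [hB.integral_mul_incrementCexp_of_le_or_le a hu hut ht (.inr le_rfl) hfu]
  simp_rw [mul_right_comm (f _)]
  rw [hB.integral_mul_incrementCexp_of_le_or_le a hu hsu hu (.inl le_rfl) hf, mul_assoc,
    ← Complex.exp_add]
  congr 2
  push_cast
  ring

lemma integral_mul_driftDensity_of_le (hB : IsBrownianOn 𝓕 Q T B) (a : ℝ) {u s t : ℝ≥0}
    (hu : u ≤ T) (hst : s ≤ t) (ht : t ≤ T) {f : Ω → ℂ} (hf : Measurable[𝓕 s] f) :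
    ∫ ω, f ω * driftDensity B a u t ω ∂Q = ∫ ω, f ω * driftDensity B a u s ω ∂Q := by
  simpa [incrementCexp] using hB.integral_mul_incrementCexp a hu hst ht hf 0

/-- `Q` with the density `driftDensity B a u T`. -/
noncomputable def driftMeasure (Q : Measure Ω) (B : ℝ≥0 → Ω → ℝ) (T : ℝ≥0) (a : ℝ) (u : ℝ≥0) :
    Measure Ω :=
  Q.withDensity fun ω => ENNReal.ofReal (driftDensity B a u T ω)

lemma integral_driftMeasure (hB : IsBrownianOn 𝓕 Q T B) (a : ℝ) {u : ℝ≥0} (hu : u ≤ T)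
    (f : Ω → ℂ) :
    ∫ ω, f ω ∂driftMeasure Q B T a u = ∫ ω, f ω * driftDensity B a u T ω ∂Q := by
  have hZ := (hB.measurable_driftDensity a hu le_rfl).mono (𝓕.le T) le_rfl
  rw [driftMeasure, integral_withDensity_eq_integral_toReal_smul hZ.ennreal_ofReal (by simp)]
  simp [ENNReal.toReal_ofReal (driftDensity_pos B a u T _).le, mul_comm]

lemma isProbabilityMeasure_driftMeasure (hB : IsBrownianOn 𝓕 Q T B) [IsProbabilityMeasure Q]
    (a : ℝ) {u : ℝ≥0} (hu : u ≤ T) : IsProbabilityMeasure (driftMeasure Q B T a u) := by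
  have hone : ∫ ω, driftDensity B a u T ω ∂Q = 1 := by
    have := hB.integral_mul_driftDensity_of_le a hu zero_le le_rfl
      (measurable_const (a := (1 : ℂ)))
    simp only [one_mul, driftDensity_zero, Complex.ofReal_one, integral_const, probReal_univ,
      one_smul] at this
    exact_mod_cast integral_complex_ofReal.symm.trans this
  refine ⟨?_⟩
  rw [driftMeasure, withDensity_apply _ MeasurableSet.univ, Measure.restrict_univ,
    ← ofReal_integral_eq_lintegral_ofReal (.of_integral_ne_zero (hone ▸ one_ne_zero))
      (.of_forall fun ω => (driftDensity_pos B a u T ω).le), hone, ENNReal.ofReal_one]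

lemma driftMeasure_absolutelyContinuous (Q : Measure Ω) (B : ℝ≥0 → Ω → ℝ) (T : ℝ≥0) (a : ℝ)
    (u : ℝ≥0) : driftMeasure Q B T a u ≪ Q :=
  withDensity_absolutelyContinuous _ _

lemma absolutelyContinuous_driftMeasure (hB : IsBrownianOn 𝓕 Q T B) (a : ℝ) {u : ℝ≥0}
    (hu : u ≤ T) : Q ≪ driftMeasure Q B T a u :=
  have hZ := (hB.measurable_driftDensity a hu le_rfl).mono (𝓕.le T) le_rfl
  withDensity_absolutelyContinuous' hZ.ennreal_ofReal.aemeasurable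
    (.of_forall fun ω => by simp [driftDensity_pos])

lemma sub_drift (hB : IsBrownianOn 𝓕 Q T B) [IsProbabilityMeasure Q] (a : ℝ) {u : ℝ≥0}
    (hu : u ≤ T) :
    IsBrownianOn 𝓕 (driftMeasure Q B T a u) T (fun t ω => B t ω - a * (t - u : ℝ≥0)) := by
  have hac := driftMeasure_absolutelyContinuous Q B T a u
  have := hB.isProbabilityMeasure_driftMeasure a hu
  refine of_setIntegral_cexp (fun t ht => (hB.adapted t ht).sub_const _) ?_ ?_
    fun s t hst ht A hA θ => ?_
  · filter_upwards [hac.ae_le hB.zero] with ω hω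
    simp [hω]
  · filter_upwards [hac.ae_le hB.cont] with ω hω
    exact hω.sub (by fun_prop : Continuous fun t : ℝ≥0 => a * (t - u : ℝ≥0)).continuousOn
  have hmA : MeasurableSet A := 𝓕.le s _ hA
  have hone : Measurable[𝓕 s] (A.indicator fun _ => (1 : ℂ)) := measurable_const.indicator hA
  have hinc : Measurable[𝓕 t] fun ω => A.indicator (fun _ => (1 : ℂ)) ω
      * incrementCexp B a u θ s t ω :=
    (hone.mono (𝓕.mono hst) le_rfl).mul (hB.measurable_incrementCexp a u θ hst ht)
  calc ∫ ω in A, incrementCexp B a u θ s t ω ∂driftMeasure Q B T a u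
      = ∫ ω, A.indicator (fun _ => 1) ω * incrementCexp B a u θ s t ω
          ∂driftMeasure Q B T a u := by
        rw [← integral_indicator hmA]
        simp [indicator]
    _ = ∫ ω, A.indicator (fun _ => 1) ω * driftDensity B a u t ω * incrementCexp B a u θ s t ω
          ∂Q := by
        rw [hB.integral_driftMeasure a hu, hB.integral_mul_driftDensity_of_le a hu ht le_rfl hinc]
        simp_rw [mul_right_comm]
    _ = (∫ ω, A.indicator (fun _ => 1) ω ∂driftMeasure Q B T a u)
          * Complex.exp (-((t - s : ℝ) * θ ^ 2 / 2)) := by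
        rw [hB.integral_mul_incrementCexp a hu hst ht hone, hB.integral_driftMeasure a hu,
          hB.integral_mul_driftDensity_of_le a hu (hst.trans ht) le_rfl hone]
    _ = _ := by
        rw [integral_indicator_const _ hmA]
        simp

lemma exists_sub_step_drift (hB : IsBrownianOn 𝓕 Q T B) [IsProbabilityMeasure Q] (n : ℕ)
    (a : ℕ → ℝ) {u : ℕ → ℝ≥0} (hu : ∀ j < n, u j ≤ T) :
    ∃ Q' : Measure Ω, IsProbabilityMeasure Q' ∧ Q' ≪ Q ∧ Q ≪ Q' ∧
      IsBrownianOn 𝓕 Q' T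
        (fun t ω => B t ω - ∑ j ∈ Finset.range n, a j * (t - u j : ℝ≥0)) := by
  induction n with
  | zero => exact ⟨Q, inferInstance, .rfl, .rfl, by simpa using hB⟩
  | succ n ih =>
    obtain ⟨Q₁, _, hac, hac', hB₁⟩ := ih fun j hj => hu j (hj.trans n.lt_succ_self)
    have hun := hu n n.lt_succ_self
    refine ⟨driftMeasure Q₁ _ T (a n) (u n), hB₁.isProbabilityMeasure_driftMeasure _ hun,
      (driftMeasure_absolutelyContinuous _ _ _ _ _).trans hac,
      hac'.trans (hB₁.absolutelyContinuous_driftMeasure _ hun), ?_⟩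
    simpa only [Finset.sum_range_succ, sub_sub] using hB₁.sub_drift (a n) hun

end IsBrownianOn

lemma isStronglyPredictable_of_measurable {Ω : Type*} [m : MeasurableSpace Ω]
    (𝓕 : Filtration ℝ≥0 m) {a : ℝ≥0 → ℝ} (ha : Measurable a) :
    IsStronglyPredictable 𝓕 fun t (_ : Ω) => a t := by
  have hfst : Measurable[𝓕.predictable] (Prod.fst : ℝ≥0 × Ω → ℝ≥0) := by
    let _ : MeasurableSpace (ℝ≥0 × Ω) := 𝓕.predictable
    refine measurable_of_Ioi fun t => ?_
    have h := measurableSet_predictable_Ioi_prod (𝓕 := 𝓕) (i := t)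
      (@MeasurableSet.univ Ω (𝓕 t))
    rwa [prod_univ] at h
  exact (ha.comp hfst).stronglyMeasurable

/-- The left-continuous step function that vanishes at `0` and jumps by `c j` immediately after
time `u j`, for `j < n`. -/
noncomputable def stepFun (n : ℕ) (c : ℕ → ℝ) (u : ℕ → ℝ≥0) (t : ℝ≥0) : ℝ :=
  ∑ j ∈ Finset.range n, c j * if u j < t then 1 else 0

@[fun_prop]
lemma measurable_stepFun (n : ℕ) (c : ℕ → ℝ) (u : ℕ → ℝ≥0) : Measurable (stepFun n c u) :=
  Finset.measurable_sum _ fun _ _ =>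
    (Measurable.ite measurableSet_Ioi measurable_const measurable_const).const_mul _

lemma ite_lt_toNNReal_eq_indicator (u : ℝ≥0) :
    (fun s : ℝ => if u < s.toNNReal then (1 : ℝ) else 0) = (Ioi (u : ℝ)).indicator 1 := by
  ext s
  simp [indicator, Real.lt_toNNReal_iff_coe_lt]

lemma intervalIntegrable_ite_lt_toNNReal (u : ℝ≥0) (a b : ℝ) :
    IntervalIntegrable (fun s : ℝ => if u < s.toNNReal then (1 : ℝ) else 0) volume a b := by
  rw [ite_lt_toNNReal_eq_indicator]
  exact ⟨(integrableOn_const (by simp)).indicator measurableSet_Ioi,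
    (integrableOn_const (by simp)).indicator measurableSet_Ioi⟩

lemma integral_ite_lt_toNNReal (u t : ℝ≥0) :
    ∫ s in (0 : ℝ)..t, (if u < s.toNNReal then (1 : ℝ) else 0) = (t - u : ℝ≥0) := by
  rw [ite_lt_toNNReal_eq_indicator, intervalIntegral.integral_of_le t.coe_nonneg,
    setIntegral_indicator measurableSet_Ioi, Ioc_inter_Ioi, max_eq_right u.coe_nonneg]
  simp [NNReal.coe_sub_def]

lemma integral_stepFun (n : ℕ) (c : ℕ → ℝ) (u : ℕ → ℝ≥0) (t : ℝ≥0) :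
    ∫ s in (0 : ℝ)..t, stepFun n c u s.toNNReal
      = ∑ j ∈ Finset.range n, c j * (t - u j : ℝ≥0) := by
  simp only [stepFun]
  rw [intervalIntegral.integral_finsetSum fun j _ =>
    (intervalIntegrable_ite_lt_toNNReal (u j) 0 t).const_mul (c j)]
  simp only [intervalIntegral.integral_const_mul, integral_ite_lt_toNNReal]

lemma stepFun_grid (G : ℕ → ℝ) {d : ℝ≥0} (hd : 0 < d) (n : ℕ) (t : ℝ≥0) :
    stepFun n (fun j => G (j + 1) - G j) (fun j => j * d) t = G (min n ⌈t / d⌉₊) - G 0 := by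
  have hlt (j : ℕ) : (j : ℝ≥0) * d < t ↔ j < ⌈t / d⌉₊ := by
    rw [Nat.lt_ceil, lt_div_iff₀ hd]
  have hfilter : {j ∈ Finset.range n | j < ⌈t / d⌉₊} = Finset.range (min n ⌈t / d⌉₊) := by
    ext j
    simp
  simp only [stepFun, hlt, mul_ite, mul_one, mul_zero]
  rw [← Finset.sum_filter, hfilter, Finset.sum_range_sub]

lemma exists_stepFun_eq_sample (f : ℝ → ℝ) (T : ℝ≥0) {d : ℝ≥0} (hd : 0 < d) :
    ∃ (n : ℕ) (c : ℕ → ℝ) (u : ℕ → ℝ≥0), (∀ j < n, u j ≤ T) ∧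
      (∀ t, stepFun n c u t ∈ insert 0 (range f)) ∧
      ∀ t ∈ Ioc 0 T, ∃ s ∈ Icc 0 t, t ≤ s + d ∧ stepFun n c u t = f s := by
  let G (j : ℕ) : ℝ := if j = 0 then 0 else f ((j - 1 : ℕ) * d)
  refine ⟨⌈T / d⌉₊, fun j => G (j + 1) - G j, fun j => j * d, fun j hj => ?_, fun t => ?_,
    fun t ht => ?_⟩
  · exact ((lt_div_iff₀ hd).1 (Nat.lt_ceil.1 hj)).le
  · rw [stepFun_grid G hd]
    by_cases h : min ⌈T / d⌉₊ ⌈t / d⌉₊ = 0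
    · simp [h]
    · exact .inr ⟨_, by simp only [G, if_neg h, if_pos, sub_zero]; rfl⟩
  · have hceil : ⌈t / d⌉₊ ≠ 0 := (Nat.ceil_pos.2 (div_pos ht.1 hd)).ne'
    obtain ⟨k, hk⟩ := Nat.exists_eq_succ_of_ne_zero hceil
    have hkt : (k : ℝ≥0) * d < t := (lt_div_iff₀ hd).1 (Nat.lt_ceil.1 (hk ▸ k.lt_succ_self))
    have htk : t ≤ (k + 1 : ℕ) * d := (div_le_iff₀ hd).1 (Nat.ceil_le.1 hk.le)
    refine ⟨k * d, ⟨zero_le, hkt.le⟩, by rwa [← add_one_mul, ← Nat.cast_succ], ?_⟩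
    rw [stepFun_grid G hd, min_eq_right (by gcongr; exact ht.2), hk]
    simp [G]

namespace PAModel

variable {Ω : Type*} [m : MeasurableSpace Ω] (M : PAModel Ω)

lemma exists_isEffortMeasure_stepFun (n : ℕ) (c : ℕ → ℝ) {u : ℕ → ℝ≥0}
    (hu : ∀ j < n, u j ≤ M.T) :
    ∃ Q : Measure Ω, M.IsEffortMeasure (fun t _ => stepFun n c u t) Q := by
  have := M.isProb
  obtain ⟨Q, hQ, hac, hac', hB⟩ :=
    (M.isBrownianOn_W M.T).exists_sub_step_drift n (fun j => c j / M.σ) hu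
  refine ⟨Q, hQ, hac, hac', ?_⟩
  convert hB using 3 with t ω
  rw [Wα, intervalIntegral.integral_div, integral_stepFun, Finset.sum_div]
  simp only [div_mul_eq_mul_div]

lemma continuousOn_h : ContinuousOn M.h (Ici 0) := M.h_contDiff.continuousOn

lemma exists_effort_approx {f : ℝ → ℝ} (hf : Continuous f) (hf_mem : ∀ t, f t ∈ Icc 0 M.abar)
    {η : ℝ} (hη : 0 < η) :
    ∃ (a : ℝ≥0 → ℝ) (Q : Measure Ω), M.Effort (fun t _ => a t) ∧
      M.IsEffortMeasure (fun t _ => a t) Q ∧ ∀ t ∈ Ioc 0 M.T,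
        |a t - f t| ≤ η ∧ |M.h (a t) - M.h (f t)| ≤ η := by
  have hhf : Continuous fun t => M.h (f t) :=
    M.continuousOn_h.comp_continuous hf fun t => (hf_mem t).1
  obtain ⟨d, hd, hdist⟩ := Metric.uniformContinuousOn_iff_le.1
    (isCompact_Icc.uniformContinuousOn_of_continuous (s := Icc (0 : ℝ) M.T)
      (hf.prodMk hhf).continuousOn) η hη
  lift d to ℝ≥0 using hd.le
  obtain ⟨n, c, u, hu, hmem, hsample⟩ := exists_stepFun_eq_sample f M.T (NNReal.coe_pos.1 hd)
  obtain ⟨Q, hQ⟩ := M.exists_isEffortMeasure_stepFun n c hu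
  refine ⟨stepFun n c u, Q,
    ⟨isStronglyPredictable_of_measurable _ (measurable_stepFun _ _ _), fun t _ => ?_⟩, hQ,
    fun t ht => ?_⟩
  · obtain h | ⟨s, h⟩ := hmem t
    · simp [h, M.abar_pos.le]
    · simpa only [h] using hf_mem s
  · obtain ⟨s, hs, hts, h⟩ := hsample t ht
    have hst : dist (s : ℝ) t ≤ d := by
      rw [Real.dist_eq, abs_sub_comm, abs_of_nonneg (sub_nonneg.2 (NNReal.coe_le_coe.2 hs.2)),
        sub_le_iff_le_add']
      exact hts
    have := hdist s ⟨s.2, hs.2.trans ht.2⟩ t ⟨t.2, ht.2⟩ hst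
    rwa [Prod.dist_eq, max_le_iff, Real.dist_eq, Real.dist_eq, ← h] at this

end PAModel

/-! ### Gains from payments and from effort -/

lemma rpow_add_mul_sub_le_rpow {p : ℝ} (hp : 1 ≤ p) {y z : ℝ} (hy : 0 ≤ y) (hz : 0 ≤ z) :
    y ^ p + p * y ^ (p - 1) * (z - y) ≤ z ^ p := by
  obtain rfl | hp := hp.eq_or_lt
  · simp
  obtain rfl | hy := hy.eq_or_lt
  · rw [Real.zero_rpow (by linarith), Real.zero_rpow (by linarith)]
    simpa using Real.rpow_nonneg hz p
  · have bernoulli := one_add_mul_self_le_rpow_one_add (s := z / y - 1)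
      (by linarith [div_nonneg hz hy.le]) hp.le
    rw [add_sub_cancel, Real.div_rpow hz hy.le, le_div_iff₀ (by positivity)] at bernoulli
    calc y ^ p + p * y ^ (p - 1) * (z - y) = (1 + p * (z / y - 1)) * y ^ p := by
          rw [Real.rpow_sub_one hy.ne']
          field_simp
      _ ≤ z ^ p := bernoulli

lemma continuous_of_unique_maximizer {X Y Z : Type*} [TopologicalSpace X] [TopologicalSpace Y]
    [CompactSpace Y] [TopologicalSpace Z] [Preorder Z] [OrderClosedTopology Z] {f : X → Y → Z}
    (hf : Continuous fun x : X × Y => f x.1 x.2) {a : X → Y}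
    (hmax : ∀ x y, f x y ≤ f x (a x)) (huniq : ∀ x y, (∀ z, f x z ≤ f x y) → y = a x) :
    Continuous a := by
  refine continuous_iff_isClosed.2 fun C hC => ?_
  have hclosed : IsClosed {x : X × Y | ∀ z, f x.1 z ≤ f x.1 x.2} := by
    simp only [ofPred_forall]
    exact isClosed_iInter fun z =>
      isClosed_le (hf.comp (continuous_fst.prodMk continuous_const)) hf
  have hpreimage :
      a ⁻¹' C = Prod.fst '' ({x : X × Y | ∀ z, f x.1 z ≤ f x.1 x.2} ∩ Prod.snd ⁻¹' C) := by
    ext x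
    constructor
    · exact fun hx => ⟨(x, a x), ⟨hmax x, hx⟩, rfl⟩
    · rintro ⟨⟨x, y⟩, ⟨hy, hyC⟩, rfl⟩
      exact (huniq x y hy ▸ hyC : a x ∈ C)
  rw [hpreimage]
  exact isClosedMap_fst_of_compactSpace _ (hclosed.inter (hC.preimage continuous_snd))

namespace PAModel

variable {Ω : Type*} [m : MeasurableSpace Ω] (M : PAModel Ω)

lemma γ_pos : 0 < M.γ := zero_lt_one.trans M.one_lt_γ

lemma δ_pos : 0 < M.δ := div_pos M.r_pos M.ρ_pos

/-- The minimizer in the definition of `Fstar κ p`, for `p ≤ 0`. -/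
noncomputable def optUtility (κ p : ℝ) : ℝ := (max (-p) 0 / ((1 + κ) * M.γ)) ^ (1 / (M.γ - 1))

lemma optUtility_nonneg {κ : ℝ} (hκ : 0 ≤ κ) (p : ℝ) : 0 ≤ M.optUtility κ p := by
  have := M.γ_pos
  unfold optUtility
  positivity

@[fun_prop]
lemma continuous_optUtility (κ : ℝ) : Continuous (M.optUtility κ) := by
  have h : 0 ≤ 1 / (M.γ - 1) := one_div_nonneg.2 (by linarith [M.one_lt_γ])
  unfold optUtility
  exact Continuous.rpow_const (by fun_prop) fun _ => .inr h

lemma marginal_optUtility {κ : ℝ} (hκ : 0 ≤ κ) {p : ℝ} (hp : p ≤ 0) :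
    (1 + κ) * (M.γ * M.optUtility κ p ^ (M.γ - 1)) = -p := by
  have hγ := M.γ_pos
  have hbase : 0 ≤ -p / ((1 + κ) * M.γ) := div_nonneg (by linarith) (by positivity)
  rw [optUtility, max_eq_left (by linarith), ← Real.rpow_mul hbase,
    one_div_mul_cancel (by linarith [M.one_lt_γ]), Real.rpow_one]
  field_simp

lemma isLeast_Fstar {κ : ℝ} (hκ : 0 ≤ κ) {p : ℝ} (hp : p ≤ 0) :
    IsLeast ((fun y => y * p - (1 + κ) * M.F y) '' Ici 0)
      (M.optUtility κ p * p + (1 + κ) * M.optUtility κ p ^ M.γ) := by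
  refine ⟨⟨M.optUtility κ p, M.optUtility_nonneg hκ p, by simp [F]⟩, ?_⟩
  rintro _ ⟨z, hz, rfl⟩
  have tangent := mul_le_mul_of_nonneg_left
    (rpow_add_mul_sub_le_rpow M.one_lt_γ.le (M.optUtility_nonneg hκ p) hz)
    (by linarith : (0 : ℝ) ≤ 1 + κ)
  simp only [F]
  linear_combination tangent - (z - M.optUtility κ p) * M.marginal_optUtility hκ hp

lemma Fstar_eq_optUtility {κ : ℝ} (hκ : 0 ≤ κ) {p : ℝ} (hp : p ≤ 0) :
    M.Fstar κ p = M.optUtility κ p * p + (1 + κ) * M.optUtility κ p ^ M.γ :=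
  (M.isLeast_Fstar hκ hp).csInf_eq

lemma Fstar_le {κ : ℝ} (hκ : 0 ≤ κ) {p : ℝ} (hp : p ≤ 0) {y : ℝ} (hy : 0 ≤ y) :
    M.Fstar κ p ≤ y * p + (1 + κ) * y ^ M.γ := by
  have h := (M.isLeast_Fstar hκ hp).2 ⟨y, hy, rfl⟩
  simpa only [M.Fstar_eq_optUtility hκ hp, F, mul_neg, sub_neg_eq_add] using h

/-- The exponent conjugate to `γ`. -/
noncomputable def γconj : ℝ := M.γ / (M.γ - 1)

lemma one_lt_γconj : 1 < M.γconj := by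
  have := M.one_lt_γ
  rw [γconj, one_lt_div (by linarith)]
  linarith

/-- The coefficient of the power function `p ↦ -Fstar κ (-p)`. -/
noncomputable def conjCoeff (κ : ℝ) : ℝ :=
  (((1 + κ) * M.γ) ^ (1 / (M.γ - 1)))⁻¹ * (1 - 1 / M.γ)

lemma conjCoeff_pos {κ : ℝ} (hκ : 0 ≤ κ) : 0 < M.conjCoeff κ := by
  have hγ := M.γ_pos
  have : 0 < 1 - 1 / M.γ := sub_pos.2 ((div_lt_one hγ).2 M.one_lt_γ)
  unfold conjCoeff
  positivity

lemma optUtility_mul_neg {κ : ℝ} (hκ : 0 ≤ κ) {p : ℝ} (hp : p ≤ 0) :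
    M.optUtility κ p * -p = (((1 + κ) * M.γ) ^ (1 / (M.γ - 1)))⁻¹ * (-p) ^ M.γconj := by
  have hγ := M.γ_pos
  have hγ' : 0 < M.γ - 1 := sub_pos.2 M.one_lt_γ
  have hγconj : M.γconj = 1 / (M.γ - 1) + 1 := by
    rw [γconj]
    field_simp
    ring
  rw [optUtility, max_eq_left (by linarith), Real.div_rpow (by linarith) (by positivity), hγconj,
    Real.rpow_add_one' (by linarith) (by positivity)]
  ring

lemma Fstar_eq {κ : ℝ} (hκ : 0 ≤ κ) {p : ℝ} (hp : p ≤ 0) :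
    M.Fstar κ p = -(M.conjCoeff κ * (-p) ^ M.γconj) := by
  have hγ := M.γ_pos
  have hpow : M.optUtility κ p ^ M.γ = M.optUtility κ p ^ (M.γ - 1) * M.optUtility κ p := by
    rw [← Real.rpow_add_one' (M.optUtility_nonneg hκ p) (by linarith), sub_add_cancel]
  calc M.Fstar κ p = -((1 - 1 / M.γ) * (M.optUtility κ p * -p)) := by
        rw [M.Fstar_eq_optUtility hκ hp, hpow]
        field_simp
        linear_combination M.optUtility κ p * M.marginal_optUtility hκ hp
    _ = -(M.conjCoeff κ * (-p) ^ M.γconj) := by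
        rw [M.optUtility_mul_neg hκ hp, conjCoeff]
        ring

/-- The optimal value, in the Lagrangian with multiplier `l` on the agent's payoff, of one payment
at time `s` with transaction cost rate `κ`: it is `bonus` for `κ = k`, and the contribution of the
terminal payment for `κ = 0` and `s = T`. -/
noncomputable def paymentGain (κ s l : ℝ) : ℝ :=
  -(Real.exp (-M.ρ * s) * M.Fstar κ (l * Real.exp ((M.ρ - M.r) * s)))

/-- The growth rate of `paymentGain` in the time of payment. -/
noncomputable def gainRate : ℝ := M.ρ * (1 - M.δ * M.γ) / (M.γ - 1)

lemma paymentGain_eq {κ : ℝ} (hκ : 0 ≤ κ) (s : ℝ) {l : ℝ} (hl : l ≤ 0) :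
    M.paymentGain κ s l = M.conjCoeff κ * (-l) ^ M.γconj * Real.exp (M.gainRate * s) := by
  have hγ : M.γ - 1 ≠ 0 := by linarith [M.one_lt_γ]
  have hρ := M.ρ_pos.ne'
  have hexp : Real.exp (M.gainRate * s)
      = Real.exp (-M.ρ * s) * Real.exp ((M.ρ - M.r) * s * M.γconj) := by
    rw [← Real.exp_add, gainRate, γconj, δ]
    congr 1
    field_simp
    ring
  rw [paymentGain, M.Fstar_eq hκ (mul_nonpos_of_nonpos_of_nonneg hl (Real.exp_pos _).le),
    ← neg_mul l, Real.mul_rpow (by linarith) (Real.exp_pos _).le, ← Real.exp_mul, hexp]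
  ring

lemma paymentGain_monotone (h : M.δ * M.γ ≤ 1) {κ : ℝ} (hκ : 0 ≤ κ) {l : ℝ} (hl : l ≤ 0) :
    Monotone fun s => M.paymentGain κ s l := by
  intro s t hst
  have hrate : 0 ≤ M.gainRate := div_nonneg
    (mul_nonneg M.ρ_pos.le (sub_nonneg.2 h)) (sub_nonneg.2 M.one_lt_γ.le)
  have := (M.conjCoeff_pos hκ).le
  have := Real.rpow_nonneg (neg_nonneg.2 hl) M.γconj
  simp only [M.paymentGain_eq hκ _ hl]
  gcongr

lemma paymentGain_antitone (h : 1 ≤ M.δ * M.γ) {κ : ℝ} (hκ : 0 ≤ κ) {l : ℝ} (hl : l ≤ 0) :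
    Antitone fun s => M.paymentGain κ s l := by
  intro s t hst
  have hrate : M.gainRate ≤ 0 := div_nonpos_of_nonpos_of_nonneg
    (mul_nonpos_of_nonneg_of_nonpos M.ρ_pos.le (sub_nonpos.2 h)) (sub_nonneg.2 M.one_lt_γ.le)
  have := (M.conjCoeff_pos hκ).le
  have := Real.rpow_nonneg (neg_nonneg.2 hl) M.γconj
  simp only [M.paymentGain_eq hκ _ hl]
  exact mul_le_mul_of_nonneg_left
    (Real.exp_le_exp.2 (mul_le_mul_of_nonpos_left hst hrate)) (by positivity)

lemma h_nonneg {a : ℝ} (ha : 0 ≤ a) : 0 ≤ M.h a :=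
  M.h_zero ▸ M.h_mono (mem_Ici.2 le_rfl) ha ha

lemma continuousOn_add_h_mul (p : ℝ) : ContinuousOn (fun a => a + M.h a * p) (Icc 0 M.abar) :=
  continuousOn_id.add ((M.continuousOn_h.mono Icc_subset_Ici_self).mul continuousOn_const)

lemma le_Gstar (p : ℝ) {a : ℝ} (ha : a ∈ Icc 0 M.abar) : a + M.h a * p ≤ M.Gstar p :=
  le_csSup (isCompact_Icc.image_of_continuousOn (M.continuousOn_add_h_mul p)).bddAbove
    ⟨a, ha, rfl⟩

lemma exists_isMaxOn_add_h_mul (p : ℝ) :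
    ∃ a : Icc 0 M.abar, IsMaxOn (fun a => a + M.h a * p) (Icc 0 M.abar) a := by
  obtain ⟨a, ha, h⟩ := isCompact_Icc.exists_isMaxOn (nonempty_Icc.2 M.abar_pos.le)
    (M.continuousOn_add_h_mul p)
  exact ⟨⟨a, ha⟩, h⟩

lemma strictConcaveOn_add_h_mul {p : ℝ} (hp : p < 0) :
    StrictConcaveOn ℝ (Icc 0 M.abar) fun a => a + M.h a * p := by
  refine ⟨convex_Icc 0 M.abar, fun a ha b hb hab s t hs ht hst => ?_⟩
  have := mul_lt_mul_of_neg_right (M.h_strictConvex.2 ha.1 hb.1 hab hs ht hst) hp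
  simp only [smul_eq_mul] at this ⊢
  linarith

lemma isMaxOn_add_h_mul_unique {p : ℝ} (hp : p ≤ 0) {a b : ℝ} (ha : a ∈ Icc 0 M.abar)
    (hb : b ∈ Icc 0 M.abar) (hma : IsMaxOn (fun a => a + M.h a * p) (Icc 0 M.abar) a)
    (hmb : IsMaxOn (fun a => a + M.h a * p) (Icc 0 M.abar) b) : a = b := by
  obtain rfl | hp := hp.eq_or_lt
  · simp only [mul_zero, add_zero] at hma hmb
    exact (hmb ha).antisymm (hma hb)
  · exact (M.strictConcaveOn_add_h_mul hp).eq_of_isMaxOn hma hmb ha hb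

/-- The optimal effort, that is, the maximizer in the definition of `Gstar p`, for `p ≤ 0`; it is
extended by its value at `0` to positive `p`. -/
noncomputable def optEffort (p : ℝ) : Icc 0 M.abar :=
  (M.exists_isMaxOn_add_h_mul (min p 0)).choose

lemma isMaxOn_optEffort (p : ℝ) :
    IsMaxOn (fun a => a + M.h a * min p 0) (Icc 0 M.abar) (M.optEffort p) :=
  (M.exists_isMaxOn_add_h_mul (min p 0)).choose_spec

@[fun_prop]
lemma continuous_optEffort : Continuous M.optEffort := by
  have hh : Continuous fun x : ℝ × Icc 0 M.abar => M.h x.2 :=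
    M.continuousOn_h.comp_continuous (by fun_prop) fun x => x.2.2.1
  refine continuous_of_unique_maximizer
    (f := fun (p : ℝ) (a : Icc 0 M.abar) => (a : ℝ) + M.h a * min p 0) (by fun_prop)
    (fun p a => M.isMaxOn_optEffort p a.2) fun p a ha => Subtype.ext ?_
  exact M.isMaxOn_add_h_mul_unique (min_le_right p 0) a.2 (M.optEffort p).2
    (fun b hb => ha ⟨b, hb⟩) (M.isMaxOn_optEffort p)

lemma Gstar_eq_optEffort {p : ℝ} (hp : p ≤ 0) :
    M.Gstar p = M.optEffort p + M.h (M.optEffort p) * p := by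
  refine IsGreatest.csSup_eq ⟨⟨M.optEffort p, (M.optEffort p).2, rfl⟩, ?_⟩
  rintro _ ⟨b, hb, rfl⟩
  have := M.isMaxOn_optEffort p hb
  rwa [min_eq_left hp] at this

/-- The optimal rate of gain from effort at time `t`, in the Lagrangian with multiplier `l`. -/
noncomputable def effortGain (l t : ℝ) : ℝ :=
  M.ρ * Real.exp (-M.ρ * t) * M.Gstar (M.δ * l * Real.exp ((M.ρ - M.r) * t))

lemma δ_mul_exp_nonpos {l : ℝ} (hl : l ≤ 0) (x : ℝ) : M.δ * l * Real.exp x ≤ 0 :=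
  mul_nonpos_of_nonpos_of_nonneg (mul_nonpos_of_nonneg_of_nonpos M.δ_pos.le hl)
    (Real.exp_pos _).le

/-- The optimal effort at time `t`, in the Lagrangian with multiplier `l`. -/
noncomputable def optEffortAt (l t : ℝ) : ℝ :=
  M.optEffort (M.δ * l * Real.exp ((M.ρ - M.r) * t))

lemma optEffortAt_mem (l t : ℝ) : M.optEffortAt l t ∈ Icc 0 M.abar :=
  (M.optEffort _).2

lemma continuous_optEffortAt : Continuous fun x : ℝ × ℝ => M.optEffortAt x.1 x.2 := by
  unfold optEffortAt
  fun_prop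

lemma continuous_h_optEffortAt : Continuous fun x : ℝ × ℝ => M.h (M.optEffortAt x.1 x.2) :=
  M.continuousOn_h.comp_continuous M.continuous_optEffortAt fun x => (M.optEffortAt_mem x.1 x.2).1

lemma exp_neg_r_mul (t : ℝ) :
    Real.exp (-M.r * t) = Real.exp (-M.ρ * t) * Real.exp ((M.ρ - M.r) * t) := by
  rw [← Real.exp_add]
  ring_nf

lemma discounted_exp_mul (t : ℝ) :
    M.ρ * Real.exp (-M.ρ * t) * (M.δ * Real.exp ((M.ρ - M.r) * t)) = M.r * Real.exp (-M.r * t) := by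
  rw [M.exp_neg_r_mul, δ]
  field_simp [M.ρ_pos.ne']

lemma effortGain_eq {l : ℝ} (hl : l ≤ 0) (t : ℝ) :
    M.effortGain l t = M.ρ * Real.exp (-M.ρ * t) * M.optEffortAt l t
      + l * (M.r * Real.exp (-M.r * t) * M.h (M.optEffortAt l t)) := by
  rw [effortGain, M.Gstar_eq_optEffort (M.δ_mul_exp_nonpos hl _), ← M.discounted_exp_mul t,
    optEffortAt]
  ring

lemma le_effortGain (l t : ℝ) {a : ℝ} (ha : a ∈ Icc 0 M.abar) :
    M.ρ * Real.exp (-M.ρ * t) * a + l * (M.r * Real.exp (-M.r * t) * M.h a)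
      ≤ M.effortGain l t := by
  have := M.ρ_pos
  rw [effortGain, ← M.discounted_exp_mul t]
  refine le_trans (le_of_eq ?_) (mul_le_mul_of_nonneg_left (M.le_Gstar _ ha) (by positivity))
  ring

lemma continuous_effortGain {l : ℝ} (hl : l ≤ 0) : Continuous (M.effortGain l) := by
  have ha : Continuous (M.optEffortAt l) :=
    M.continuous_optEffortAt.comp (f := fun t => (l, t)) (by fun_prop)
  have hh : Continuous fun t => M.h (M.optEffortAt l t) :=
    M.continuous_h_optEffortAt.comp (f := fun t => (l, t)) (by fun_prop)
  simp only [funext (M.effortGain_eq hl)]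
  fun_prop

end PAModel

lemma predictable_le_prod {Ω : Type*} [m : MeasurableSpace Ω] (𝓕 : Filtration ℝ≥0 m) :
    𝓕.predictable ≤ (inferInstance : MeasurableSpace (ℝ≥0 × Ω)) :=
  measurableSpace_le_predictable_of_measurableSet
    (fun _ hA => (measurableSet_singleton _).prod (𝓕.le _ _ hA))
    (fun _ _ hA => measurableSet_Ioi.prod (𝓕.le _ _ hA))

lemma integrable_of_integrable_abs_rpow {α : Type*} {m : MeasurableSpace α} {μ : Measure α}
    [IsFiniteMeasure μ] {f : α → ℝ} (hf : AEStronglyMeasurable f μ) {p : ℝ} (hp : 1 ≤ p)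
    (hfp : Integrable (fun x => |f x| ^ p) μ) : Integrable f μ := by
  have hp0 : 0 < p := by linarith
  have hfp' : Integrable (fun x => ‖f x‖ ^ (ENNReal.ofReal p).toReal) μ := by
    simpa only [ENNReal.toReal_ofReal hp0.le, Real.norm_eq_abs] using hfp
  have hmem := (integrable_norm_rpow_iff hf (by simpa using hp0) ENNReal.ofReal_ne_top).1 hfp'
  exact hmem.integrable (ENNReal.one_le_ofReal.2 hp)

namespace PAModel

variable {Ω : Type*} [m : MeasurableSpace Ω] {M : PAModel Ω} {α : ℝ≥0 → Ω → ℝ} {Q : Measure Ω}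

section Effort

variable {w H : ℝ → ℝ}

lemma Effort.measurable_weighted (hα : M.Effort α) (hw : Continuous w)
    (hH : ContinuousOn H (Icc 0 M.abar)) :
    Measurable (Function.uncurry fun (ω : Ω) (t : ℝ) => w t * H (α t.toNNReal ω)) := by
  have hα' : Measurable (Function.uncurry α) :=
    hα.1.measurable.mono (predictable_le_prod _) le_rfl
  have hext : Continuous (IccExtend M.abar_pos.le ((Icc 0 M.abar).domRestrict H)) :=
    (continuousOn_iff_continuous_domRestrict.1 hH).Icc_extend'
  have hHα : ∀ (t : ℝ) ω, H (α t.toNNReal ω)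
      = IccExtend M.abar_pos.le ((Icc 0 M.abar).domRestrict H) (α t.toNNReal ω) := fun t ω =>
    (IccExtend_of_mem M.abar_pos.le ((Icc 0 M.abar).domRestrict H) (hα.2 t.toNNReal ω)).symm
  simp only [hHα]
  exact (hw.measurable.comp measurable_snd).mul (hext.measurable.comp (hα'.comp
    ((measurable_real_toNNReal.comp measurable_snd).prodMk measurable_fst)))

lemma Effort.exists_bound_weighted (hα : M.Effort α) (hw : Continuous w)
    (hH : ContinuousOn H (Icc 0 M.abar)) :
    ∃ K, ∀ ω, ∀ t ∈ uIoc (0 : ℝ) M.T, ‖w t * H (α t.toNNReal ω)‖ ≤ K := by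
  obtain ⟨c, hc⟩ := (isCompact_uIcc (a := (0 : ℝ)) (b := M.T)).exists_bound_of_continuousOn
    hw.continuousOn
  obtain ⟨K, hK⟩ := isCompact_Icc.exists_bound_of_continuousOn hH
  refine ⟨c * K, fun ω t ht => ?_⟩
  have hct := hc t (uIoc_subset_uIcc ht)
  rw [norm_mul]
  exact mul_le_mul hct (hK _ (hα.2 _ _)) (norm_nonneg _) ((norm_nonneg _).trans hct)

lemma Effort.intervalIntegrable_weighted (hα : M.Effort α) (hw : Continuous w)
    (hH : ContinuousOn H (Icc 0 M.abar)) (ω : Ω) :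
    IntervalIntegrable (fun t => w t * H (α t.toNNReal ω)) volume 0 M.T := by
  obtain ⟨K, hK⟩ := hα.exists_bound_weighted hw hH
  refine (intervalIntegrable_const (c := K)).mono_fun
    ((hα.measurable_weighted hw hH).comp measurable_prodMk_left).aestronglyMeasurable ?_
  exact (ae_restrict_iff' measurableSet_uIoc).2
    (.of_forall fun t ht => (hK ω t ht).trans (le_abs_self K))

lemma Effort.integrable_integral_weighted (hα : M.Effort α) [IsFiniteMeasure Q]
    (hw : Continuous w) (hH : ContinuousOn H (Icc 0 M.abar)) :
    Integrable (fun ω => ∫ t in (0 : ℝ)..M.T, w t * H (α t.toNNReal ω)) Q := by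
  obtain ⟨K, hK⟩ := hα.exists_bound_weighted hw hH
  refine Integrable.of_bound ?_ (K * |(M.T : ℝ) - 0|)
    (.of_forall fun ω => intervalIntegral.norm_integral_le_of_norm_le_const (hK ω))
  simp_rw [intervalIntegral.integral_of_le M.T.coe_nonneg]
  exact ((hα.measurable_weighted hw hH).stronglyMeasurable.integral_prod_right
    (ν := volume.restrict (Ioc (0 : ℝ) M.T))).aestronglyMeasurable

end Effort

section Utility

variable (M)

lemma u_nonneg {x : ℝ} (hx : 0 ≤ x) : 0 ≤ M.u x := Real.rpow_nonneg hx _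

lemma u_rpow {x : ℝ} (hx : 0 ≤ x) : M.u x ^ M.γ = x := by
  rw [u, ← Real.rpow_mul hx, one_div_mul_cancel M.γ_pos.ne', Real.rpow_one]

lemma integrable_u [IsFiniteMeasure Q] {ξ : Ω → ℝ} (hξ : ∀ ω, 0 ≤ ξ ω) (h : Integrable ξ Q) :
    Integrable (fun ω => M.u (ξ ω)) Q := by
  refine integrable_of_integrable_abs_rpow
    (h.aemeasurable.pow_const (1 / M.γ)).aestronglyMeasurable M.one_lt_γ.le ?_
  simpa only [abs_of_nonneg (M.u_nonneg (hξ _)), M.u_rpow (hξ _)] using h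

end Utility

namespace Admissible

variable {C : Contract M.N Ω} (hC : M.Admissible C)

include hC

lemma measurable_ξ (i : Fin M.N) : Measurable (C.ξ i) :=
  (hC.ξ_meas i).mono (hC.stopping i).measurableSpace_le le_rfl

lemma measurable_τ (i : Fin M.N) : Measurable (C.τ i) := by
  refine measurable_of_Iic fun t => ?_
  have h : MeasurableSet {ω | (C.τ i ω : WithTop ℝ≥0) ≤ t} := M.𝓕.le t _ (hC.stopping i t)
  simp only [WithTop.coe_le_coe] at h
  exact h

lemma integrable_payments (hα : M.Effort α) (hQ : M.IsEffortMeasure α Q) (i : Fin M.N) :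
    Integrable (C.ξ i) Q ∧ Integrable C.ξT Q := by
  have := hQ.isProb
  have hfin : (∫⁻ ω, ENNReal.ofReal (|C.ξ i ω| ^ M.γ) ∂Q) +
      ∫⁻ ω, ENNReal.ofReal (|C.ξT ω| ^ M.γ) ∂Q < ∞ := by
    refine lt_of_le_of_lt ?_ hC.integrability
    exact le_iSup_of_le i <| le_iSup_of_le α <| le_iSup_of_le Q <| le_iSup_of_le hα <|
      le_iSup_of_le hQ le_rfl
  have integrable_of_lintegral {ξ : Ω → ℝ} (hξ : Measurable ξ)
      (h : ∫⁻ ω, ENNReal.ofReal (|ξ ω| ^ M.γ) ∂Q < ∞) : Integrable ξ Q := by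
    refine integrable_of_integrable_abs_rpow hξ.aestronglyMeasurable M.one_lt_γ.le
      ⟨Measurable.aestronglyMeasurable (by fun_prop), ?_⟩
    rwa [hasFiniteIntegral_iff_ofReal (.of_forall fun ω => by positivity)]
  obtain ⟨hi, hT⟩ := ENNReal.add_lt_top.1 hfin
  exact ⟨integrable_of_lintegral (hC.measurable_ξ i) hi,
    integrable_of_lintegral (hC.ξT_meas.mono (M.𝓕.le _) le_rfl) hT⟩

lemma integrable_ξ (hα : M.Effort α) (hQ : M.IsEffortMeasure α Q) (i : Fin M.N) :
    Integrable (C.ξ i) Q :=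
  (hC.integrable_payments hα hQ i).1

lemma integrable_ξT (hα : M.Effort α) (hQ : M.IsEffortMeasure α Q) : Integrable C.ξT Q :=
  (hC.integrable_payments hα hQ ⟨0, M.one_le_N⟩).2

lemma integrable_discounted {q : ℝ} (hq : 0 ≤ q) (i : Fin M.N) {f : Ω → ℝ}
    (hf : Integrable f Q) : Integrable (fun ω => Real.exp (-q * C.τ i ω) * f ω) Q := by
  have := hC.measurable_τ i
  refine hf.bdd_mul (c := 1) (Measurable.aestronglyMeasurable (by fun_prop))
    (.of_forall fun ω => ?_)
  rw [Real.norm_of_nonneg (Real.exp_pos _).le, Real.exp_le_one_iff, neg_mul, neg_nonpos]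
  positivity

end Admissible

end PAModel

/-! ### Weak duality -/

namespace PAModel

variable {Ω : Type*} [m : MeasurableSpace Ω] (M : PAModel Ω)

lemma payment_le_paymentGain {κ : ℝ} (hκ : 0 ≤ κ) {l : ℝ} (hl : l ≤ 0) {y : ℝ} (hy : 0 ≤ y)
    (s : ℝ) :
    -(Real.exp (-M.ρ * s) * ((1 + κ) * y ^ M.γ)) - l * (Real.exp (-M.r * s) * y)
      ≤ M.paymentGain κ s l := by
  have h := mul_le_mul_of_nonneg_left
    (M.Fstar_le hκ (mul_nonpos_of_nonpos_of_nonneg hl (Real.exp_pos ((M.ρ - M.r) * s)).le) hy)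
    (Real.exp_pos (-M.ρ * s)).le
  rw [paymentGain, M.exp_neg_r_mul]
  linear_combination h

/-- The agent's payoff on the outcome `ω`, whose expectation is `JA`. -/
noncomputable def agentPayoff (C : Contract M.N Ω) (α : ℝ≥0 → Ω → ℝ) (ω : Ω) : ℝ :=
  (∑ i, Real.exp (-M.r * C.τ i ω) * M.u (C.ξ i ω))
    + Real.exp (-M.r * M.T) * M.u (C.ξT ω)
    - ∫ t in (0 : ℝ)..M.T, M.r * Real.exp (-M.r * t) * M.h (α t.toNNReal ω)

/-- The principal's payoff on the outcome `ω`, whose expectation is `JP`. -/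
noncomputable def principalPayoff (C : Contract M.N Ω) (α : ℝ≥0 → Ω → ℝ) (ω : Ω) : ℝ :=
  -(∑ i, Real.exp (-M.ρ * C.τ i ω) * ((1 + M.k) * C.ξ i ω))
    - Real.exp (-M.ρ * M.T) * C.ξT ω
    + ∫ t in (0 : ℝ)..M.T, M.ρ * Real.exp (-M.ρ * t) * α t.toNNReal ω

/-- The dual function minimized in `dualInf`, with the contribution `B` of the bonuses. -/
noncomputable def dualFun (R B l : ℝ) : ℝ :=
  l * M.u R + B + M.paymentGain 0 M.T l + ∫ t in (0 : ℝ)..M.T, M.effortGain l t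

variable {M} {C : Contract M.N Ω} {α : ℝ≥0 → Ω → ℝ} {Q : Measure Ω} {l : ℝ}

lemma Effort.intervalIntegrable_cost (hα : M.Effort α) (ω : Ω) :
    IntervalIntegrable (fun t => M.r * Real.exp (-M.r * t) * M.h (α t.toNNReal ω))
      volume 0 M.T :=
  hα.intervalIntegrable_weighted (by fun_prop) (M.continuousOn_h.mono Icc_subset_Ici_self) ω

lemma Effort.intervalIntegrable_output (hα : M.Effort α) (ω : Ω) :
    IntervalIntegrable (fun t => M.ρ * Real.exp (-M.ρ * t) * α t.toNNReal ω) volume 0 M.T :=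
  hα.intervalIntegrable_weighted (H := id) (by fun_prop) continuousOn_id ω

lemma Admissible.integrable_agentPayoff (hC : M.Admissible C) (hα : M.Effort α)
    (hQ : M.IsEffortMeasure α Q) : Integrable (M.agentPayoff C α) Q := by
  have := hQ.isProb
  have bonuses := integrable_finsetSum Finset.univ fun i _ => hC.integrable_discounted M.r_pos.le i
    (M.integrable_u (hC.ξ_nonneg i) (hC.integrable_ξ hα hQ i))
  have terminal := M.integrable_u hC.ξT_nonneg (hC.integrable_ξT hα hQ)
  have effort : Integrable (fun ω => ∫ t in (0 : ℝ)..M.T,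
      M.r * Real.exp (-M.r * t) * M.h (α t.toNNReal ω)) Q :=
    hα.integrable_integral_weighted (by fun_prop) (M.continuousOn_h.mono Icc_subset_Ici_self)
  exact (bonuses.add (terminal.const_mul _)).sub effort

lemma Admissible.integrable_principalPayoff (hC : M.Admissible C) (hα : M.Effort α)
    (hQ : M.IsEffortMeasure α Q) : Integrable (M.principalPayoff C α) Q := by
  have := hQ.isProb
  have bonuses := integrable_finsetSum Finset.univ fun i _ => hC.integrable_discounted M.ρ_pos.le i
    ((hC.integrable_ξ hα hQ i).const_mul (1 + M.k))
  have terminal := hC.integrable_ξT hα hQ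
  have effort : Integrable (fun ω => ∫ t in (0 : ℝ)..M.T,
      M.ρ * Real.exp (-M.ρ * t) * α t.toNNReal ω) Q :=
    hα.integrable_integral_weighted (H := id) (by fun_prop) continuousOn_id
  exact (bonuses.neg.sub (terminal.const_mul _)).add effort

lemma Effort.lagrangian_le (hα : M.Effort α) (hl : l ≤ 0) (ω : Ω) :
    (∫ t in (0 : ℝ)..M.T, M.ρ * Real.exp (-M.ρ * t) * α t.toNNReal ω)
      + l * (∫ t in (0 : ℝ)..M.T, M.r * Real.exp (-M.r * t) * M.h (α t.toNNReal ω))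
      ≤ ∫ t in (0 : ℝ)..M.T, M.effortGain l t := by
  have hcost := (hα.intervalIntegrable_cost ω).const_mul l
  rw [← intervalIntegral.integral_const_mul,
    ← intervalIntegral.integral_add (hα.intervalIntegrable_output ω) hcost]
  exact intervalIntegral.integral_mono_on M.T.coe_nonneg
    ((hα.intervalIntegrable_output ω).add hcost)
    ((M.continuous_effortGain hl).intervalIntegrable _ _)
    fun t _ => M.le_effortGain l t (hα.2 _ ω)

lemma Admissible.lagrangian_le (hC : M.Admissible C) (hα : M.Effort α) (hl : l ≤ 0) {B : ℝ}
    (hB : ∀ s ∈ Icc (0 : ℝ) M.T, M.bonus s l ≤ B) (R : ℝ) (ω : Ω) :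
    M.principalPayoff C α ω - l * M.agentPayoff C α ω
      ≤ M.dualFun R (M.N * B) l - l * M.u R := by
  have payment_le {κ x : ℝ} (hκ : 0 ≤ κ) (hx : 0 ≤ x) (s : ℝ) :
      -(Real.exp (-M.ρ * s) * ((1 + κ) * x)) - l * (Real.exp (-M.r * s) * M.u x)
        ≤ M.paymentGain κ s l := by
    simpa only [M.u_rpow hx] using M.payment_le_paymentGain hκ hl (M.u_nonneg hx) s
  have bonuses : -(∑ i, Real.exp (-M.ρ * C.τ i ω) * ((1 + M.k) * C.ξ i ω))
      - l * (∑ i, Real.exp (-M.r * C.τ i ω) * M.u (C.ξ i ω)) ≤ M.N * B := by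
    rw [Finset.mul_sum, ← Finset.sum_neg_distrib, ← Finset.sum_sub_distrib]
    calc _ ≤ ∑ _i : Fin M.N, B := Finset.sum_le_sum fun i _ =>
          (payment_le M.k_pos.le (hC.ξ_nonneg i ω) _).trans
            (hB _ ⟨(C.τ i ω).coe_nonneg, (hC.lt_T i ω).le⟩)
      _ = M.N * B := by simp
  have terminal := payment_le le_rfl (hC.ξT_nonneg ω) M.T
  have effort := hα.lagrangian_le hl ω
  rw [principalPayoff, agentPayoff, dualFun]
  linarith

lemma Admissible.JP_le_dualFun (hC : M.Admissible C) (hα : M.Effort α)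
    (hQ : M.IsEffortMeasure α Q) {R : ℝ} (hR : M.u R ≤ M.JA C α Q) (hl : l ≤ 0) {B : ℝ}
    (hB : ∀ s ∈ Icc (0 : ℝ) M.T, M.bonus s l ≤ B) :
    M.JP C α Q ≤ M.dualFun R (M.N * B) l := by
  have := hQ.isProb
  have hA := (hC.integrable_agentPayoff hα hQ).const_mul l
  have hP := hC.integrable_principalPayoff hα hQ
  have lagrangian := calc
    M.JP C α Q - l * M.JA C α Q
        = ∫ ω, (M.principalPayoff C α ω - l * M.agentPayoff C α ω) ∂Q := by
          rw [integral_sub hP hA, integral_const_mul]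
          rfl
    _ ≤ ∫ _, (M.dualFun R (M.N * B) l - l * M.u R) ∂Q :=
          integral_mono (hP.sub hA) (integrable_const _) (hC.lagrangian_le hα hl hB R)
    _ = M.dualFun R (M.N * B) l - l * M.u R := by simp
  have participation := mul_le_mul_of_nonpos_left hR hl
  linarith

variable (M) in
lemma VFB_le_dualFun {R B : ℝ} (hl : l ≤ 0) (hB : ∀ s ∈ Icc (0 : ℝ) M.T, M.bonus s l ≤ B) :
    M.VFB R ≤ M.dualFun R (M.N * B) l := by
  refine sSup_le ?_
  rintro _ ⟨C, α, Q, hC, hα, hQ, hR, rfl⟩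
  exact EReal.coe_le_coe (hC.JP_le_dualFun hα hQ hR hl hB)

end PAModel

/-! ### Deterministic plans -/

lemma integral_discount (q T : ℝ) :
    ∫ t in (0 : ℝ)..T, q * Real.exp (-q * t) = 1 - Real.exp (-q * T) := by
  have h (t : ℝ) : HasDerivAt (fun t => -Real.exp (-q * t)) (q * Real.exp (-q * t)) t :=
    ((hasDerivAt_const_mul (-q)).exp.neg).congr_deriv (by ring)
  rw [intervalIntegral.integral_eq_sub_of_hasDerivAt (fun t _ => h t)
    (Continuous.intervalIntegrable (by fun_prop) _ _), mul_zero, Real.exp_zero]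
  ring

lemma integral_discounted_le_add {q T η : ℝ} (hq : 0 ≤ q) (hT : 0 ≤ T) (hη : 0 ≤ η) {f g : ℝ → ℝ}
    (hf : IntervalIntegrable (fun t => q * Real.exp (-q * t) * f t) volume 0 T)
    (hg : IntervalIntegrable (fun t => q * Real.exp (-q * t) * g t) volume 0 T)
    (hfg : ∀ t ∈ Ioo 0 T, f t ≤ g t + η) :
    ∫ t in (0 : ℝ)..T, q * Real.exp (-q * t) * f t
      ≤ (∫ t in (0 : ℝ)..T, q * Real.exp (-q * t) * g t) + η := by
  have hconst : IntervalIntegrable (fun t => q * Real.exp (-q * t) * η) volume 0 T :=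
    Continuous.intervalIntegrable (by fun_prop) _ _
  calc ∫ t in (0 : ℝ)..T, q * Real.exp (-q * t) * f t
      ≤ ∫ t in (0 : ℝ)..T, (q * Real.exp (-q * t) * g t + q * Real.exp (-q * t) * η) := by
        refine intervalIntegral.integral_mono_on_of_le_Ioo hT hf (hg.add hconst) fun t ht => ?_
        rw [← mul_add]
        exact mul_le_mul_of_nonneg_left (hfg t ht) (by positivity)
    _ = (∫ t in (0 : ℝ)..T, q * Real.exp (-q * t) * g t) + (1 - Real.exp (-q * T)) * η := by
        rw [intervalIntegral.integral_add hg hconst, intervalIntegral.integral_mul_const,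
          integral_discount]
    _ ≤ (∫ t in (0 : ℝ)..T, q * Real.exp (-q * t) * g t) + η := by
        nlinarith [Real.exp_pos (-q * T)]

/-- A deterministic plan: `N` times of payment, the agent's utilities of the bonuses and of the
terminal payment, and an effort. Payments are encoded by their utilities since the principal's
value is concave in these. -/
structure DetPlan (N : ℕ) where
  time : Fin N → ℝ
  bonusUtility : Fin N → ℝ
  terminalUtility : ℝ
  effort : ℝ → ℝ

namespace PAModel

variable {Ω : Type*} [m : MeasurableSpace Ω] (M : PAModel Ω)

/-- Feasibility of the payments of a deterministic plan. -/
structure FeasiblePayments (p : DetPlan M.N) : Prop where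
  time_mono : Monotone p.time
  time_mem : ∀ i, p.time i ∈ Ico (0 : ℝ) M.T
  bonusUtility_nonneg : ∀ i, 0 ≤ p.bonusUtility i
  terminalUtility_nonneg : 0 ≤ p.terminalUtility

/-- The agent's payoff from a deterministic plan. -/
noncomputable def agentValue (p : DetPlan M.N) : ℝ :=
  (∑ i, Real.exp (-M.r * p.time i) * p.bonusUtility i)
    + Real.exp (-M.r * M.T) * p.terminalUtility
    - ∫ t in (0 : ℝ)..M.T, M.r * Real.exp (-M.r * t) * M.h (p.effort t)

/-- The principal's payoff from a deterministic plan. -/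
noncomputable def principalValue (p : DetPlan M.N) : ℝ :=
  -(∑ i, Real.exp (-M.ρ * p.time i) * ((1 + M.k) * p.bonusUtility i ^ M.γ))
    - Real.exp (-M.ρ * M.T) * p.terminalUtility ^ M.γ
    + ∫ t in (0 : ℝ)..M.T, M.ρ * Real.exp (-M.ρ * t) * p.effort t

/-- The contract of a deterministic plan. -/
noncomputable def detContract (p : DetPlan M.N) : Contract M.N Ω where
  τ i _ := (p.time i).toNNReal
  ξ i _ := p.bonusUtility i ^ M.γ
  ξT _ := p.terminalUtility ^ M.γ

lemma u_of_rpow {y : ℝ} (hy : 0 ≤ y) : M.u (y ^ M.γ) = y := by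
  rw [u, ← Real.rpow_mul hy, mul_one_div_cancel M.γ_pos.ne', Real.rpow_one]

namespace FeasiblePayments

variable {M} {p : DetPlan M.N} (hp : M.FeasiblePayments p)

include hp

lemma admissible_detContract : M.Admissible (M.detContract p) where
  stopping i := isStoppingTime_const _ _
  lt_T i _ := (Real.toNNReal_lt_iff_lt_coe (hp.time_mem i).1).2 (hp.time_mem i).2
  increasing _ _ _ hij := Real.toNNReal_le_toNNReal (hp.time_mono hij)
  ξ_nonneg i _ := Real.rpow_nonneg (hp.bonusUtility_nonneg i) _
  ξ_meas i := measurable_const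
  ξT_nonneg _ := Real.rpow_nonneg hp.terminalUtility_nonneg _
  ξT_meas := measurable_const
  integrability := by
    let c (i : Fin M.N) : ℝ≥0∞ := ENNReal.ofReal (|p.bonusUtility i ^ M.γ| ^ M.γ)
      + ENNReal.ofReal (|p.terminalUtility ^ M.γ| ^ M.γ)
    refine lt_of_le_of_lt (b := ∑ i, c i) ?_ (ENNReal.sum_lt_top.2 fun i _ => by simp [c])
    refine iSup_le fun i => iSup_le fun α => iSup_le fun Q => iSup_le fun _ =>
      iSup_le fun hQ => ?_
    have := hQ.isProb
    simp only [detContract, lintegral_const, measure_univ, mul_one]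
    exact Finset.single_le_sum (f := c) (fun _ _ => zero_le) (Finset.mem_univ i)

lemma principalValue_le_VFB_of_isEffortMeasure {a : ℝ≥0 → ℝ} {Q : Measure Ω}
    (ha : M.Effort fun t _ => a t) (hQ : M.IsEffortMeasure (fun t _ => a t) Q)
    (hpa : ∀ t, p.effort t = a t.toNNReal) {R : ℝ} (hR : M.u R ≤ M.agentValue p) :
    M.principalValue p ≤ M.VFB R := by
  have := hQ.isProb
  have htime (i) : ((p.time i).toNNReal : ℝ) = p.time i := Real.coe_toNNReal _ (hp.time_mem i).1
  have hbonus (i) := M.u_of_rpow (hp.bonusUtility_nonneg i)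
  refine le_sSup ⟨M.detContract p, fun t _ => a t, Q, hp.admissible_detContract, ha, hQ, ?_, ?_⟩
  · simpa [JA, detContract, htime, hbonus, M.u_of_rpow hp.terminalUtility_nonneg, agentValue, hpa]
      using hR
  · simp [JP, detContract, htime, principalValue, hpa]

/-- The terminal payment compensates the agent for the error in approximating the effort. -/
lemma principalValue_sub_le_VFB (hcont : Continuous p.effort)
    (hmem : ∀ t, p.effort t ∈ Icc 0 M.abar) {R : ℝ} (hR : M.u R ≤ M.agentValue p) {η : ℝ}
    (hη : 0 < η) :
    ((M.principalValue
      { p with terminalUtility := p.terminalUtility + Real.exp (M.r * M.T) * η } - η : ℝ) : EReal)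
      ≤ M.VFB R := by
  obtain ⟨a, Q, ha, hQ, happrox⟩ := M.exists_effort_approx hcont hmem hη
  have := hQ.isProb
  obtain ⟨ω⟩ := nonempty_of_isProbabilityMeasure Q
  have happrox' (t : ℝ) (ht : t ∈ Ioo (0 : ℝ) M.T) := happrox t.toNNReal
    ⟨Real.toNNReal_pos.2 ht.1, (Real.toNNReal_le_iff_le_coe).2 ht.2.le⟩
  have hcost_cont : Continuous fun t => M.h (p.effort t) :=
    M.continuousOn_h.comp_continuous hcont fun t => (hmem t).1
  have cost := integral_discounted_le_add M.r_pos.le M.T.coe_nonneg hη.le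
    (ha.intervalIntegrable_cost ω) (g := fun t => M.h (p.effort t))
    (Continuous.intervalIntegrable (by fun_prop) _ _) fun t ht => by
      have := (abs_le.1 (happrox' t ht).2).2
      rw [Real.coe_toNNReal t ht.1.le] at this
      linarith
  have output := integral_discounted_le_add M.ρ_pos.le M.T.coe_nonneg hη.le
    (f := p.effort) (Continuous.intervalIntegrable (by fun_prop) _ _)
    (ha.intervalIntegrable_output ω) fun t ht => by
      have := (abs_le.1 (happrox' t ht).1).1
      rw [Real.coe_toNNReal t ht.1.le] at this
      linarith
  let p' : DetPlan M.N :=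
    { p with terminalUtility := p.terminalUtility + Real.exp (M.r * M.T) * η
             effort := fun t => a t.toNNReal }
  have hp' : M.FeasiblePayments p' :=
    { hp with terminalUtility_nonneg := add_nonneg hp.terminalUtility_nonneg (by positivity) }
  have hcancel : Real.exp (-M.r * M.T) * (Real.exp (M.r * M.T) * η) = η := by
    rw [← mul_assoc, ← Real.exp_add]
    simp
  refine le_trans (EReal.coe_le_coe ?_)
    (hp'.principalValue_le_VFB_of_isEffortMeasure ha hQ (fun _ => rfl) ?_)
  · simp only [principalValue, p']
    linarith
  · simp only [agentValue, p', mul_add, hcancel] at hR ⊢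
    linarith

lemma principalValue_le_VFB (hcont : Continuous p.effort) (hmem : ∀ t, p.effort t ∈ Icc 0 M.abar)
    {R : ℝ} (hR : M.u R ≤ M.agentValue p) : M.principalValue p ≤ M.VFB R := by
  have hpow : Continuous fun η : ℝ => (p.terminalUtility + Real.exp (M.r * M.T) * η) ^ M.γ :=
    Continuous.rpow_const (by fun_prop) fun _ => .inr M.γ_pos.le
  have hlim : Continuous fun η : ℝ => ((M.principalValue
      { p with terminalUtility := p.terminalUtility + Real.exp (M.r * M.T) * η } - η : ℝ) :
        EReal) := by
    refine continuous_coe_real_ereal.comp ?_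
    simp only [principalValue]
    fun_prop
  have hle := le_of_tendsto ((hlim.tendsto 0).mono_left (nhdsWithin_le_nhds (s := Ioi 0)))
    (eventually_nhdsWithin_of_forall fun η hη =>
      hp.principalValue_sub_le_VFB hcont hmem hR hη)
  simpa using hle

end FeasiblePayments

/-- The plan that attains the dual function at the multiplier `l`, for the payment times `s`. -/
noncomputable def optPlan (s : Fin M.N → ℝ) (l : ℝ) : DetPlan M.N where
  time := s
  bonusUtility i := M.optUtility M.k (l * Real.exp ((M.ρ - M.r) * s i))
  terminalUtility := M.optUtility 0 (l * Real.exp ((M.ρ - M.r) * M.T))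
  effort := M.optEffortAt l

lemma paymentGain_eq_optUtility {κ : ℝ} (hκ : 0 ≤ κ) (s : ℝ) {l : ℝ} (hl : l ≤ 0) :
    M.paymentGain κ s l
      = -(Real.exp (-M.ρ * s) *
          ((1 + κ) * M.optUtility κ (l * Real.exp ((M.ρ - M.r) * s)) ^ M.γ))
        - l * (Real.exp (-M.r * s) * M.optUtility κ (l * Real.exp ((M.ρ - M.r) * s))) := by
  rw [paymentGain, M.exp_neg_r_mul,
    M.Fstar_eq_optUtility hκ (mul_nonpos_of_nonpos_of_nonneg hl (Real.exp_pos _).le)]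
  ring

lemma dualFun_eq_optPlan (R : ℝ) (s : Fin M.N → ℝ) {l : ℝ} (hl : l ≤ 0) :
    M.dualFun R (∑ i, M.bonus (s i) l) l
      = M.principalValue (M.optPlan s l) - l * (M.agentValue (M.optPlan s l) - M.u R) := by
  have heffort : Continuous (M.optEffortAt l) :=
    M.continuous_optEffortAt.comp (f := fun t => (l, t)) (by fun_prop)
  have hcost : Continuous fun t => M.h (M.optEffortAt l t) :=
    M.continuous_h_optEffortAt.comp (f := fun t => (l, t)) (by fun_prop)
  have effort : ∫ t in (0 : ℝ)..M.T, M.effortGain l t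
      = (∫ t in (0 : ℝ)..M.T, M.ρ * Real.exp (-M.ρ * t) * M.optEffortAt l t)
        + l * ∫ t in (0 : ℝ)..M.T, M.r * Real.exp (-M.r * t) * M.h (M.optEffortAt l t) := by
    simp only [M.effortGain_eq hl]
    rw [intervalIntegral.integral_add (Continuous.intervalIntegrable (by fun_prop) _ _)
      (Continuous.intervalIntegrable (by fun_prop) _ _), intervalIntegral.integral_const_mul]
  have bonuses : ∑ i, M.bonus (s i) l
      = -(∑ i, Real.exp (-M.ρ * s i) * ((1 + M.k) * (M.optPlan s l).bonusUtility i ^ M.γ))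
        - l * ∑ i, Real.exp (-M.r * s i) * (M.optPlan s l).bonusUtility i := by
    rw [Finset.mul_sum, ← Finset.sum_neg_distrib, ← Finset.sum_sub_distrib]
    exact Finset.sum_congr rfl fun i _ => M.paymentGain_eq_optUtility M.k_pos.le (s i) hl
  rw [dualFun, bonuses, effort, M.paymentGain_eq_optUtility le_rfl M.T hl]
  simp only [principalValue, agentValue, optPlan]
  ring

lemma continuous_agentValue_optPlan (s : Fin M.N → ℝ) :
    Continuous fun l => M.agentValue (M.optPlan s l) := by
  have cost : Continuous fun x : ℝ × ℝ =>
      M.r * Real.exp (-M.r * x.2) * M.h (M.optEffortAt x.1 x.2) :=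
    Continuous.mul (by fun_prop) M.continuous_h_optEffortAt
  have payments : Continuous fun l =>
      (∑ i, Real.exp (-M.r * s i) * (M.optPlan s l).bonusUtility i)
        + Real.exp (-M.r * M.T) * (M.optPlan s l).terminalUtility := by
    simp only [optPlan]
    fun_prop
  exact payments.sub
    (intervalIntegral.continuous_parametric_intervalIntegral_of_continuous' cost _ _)

lemma tendsto_optUtility_atBot {κ : ℝ} (hκ : 0 ≤ κ) :
    Filter.Tendsto (M.optUtility κ) Filter.atBot Filter.atTop := by
  have hγ := M.γ_pos
  have hexponent : 0 < 1 / (M.γ - 1) := one_div_pos.2 (by linarith [M.one_lt_γ])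
  have hmax : Filter.Tendsto (fun p : ℝ => max (-p) 0) Filter.atBot Filter.atTop :=
    Filter.tendsto_atTop_mono (fun p => le_max_left (-p) 0) Filter.tendsto_neg_atBot_atTop
  exact (tendsto_rpow_atTop hexponent).comp (hmax.atTop_div_const (by positivity))

lemma agentValue_optPlan_zero_nonpos (s : Fin M.N → ℝ) : M.agentValue (M.optPlan s 0) ≤ 0 := by
  have hexponent : 1 / (M.γ - 1) ≠ 0 := one_div_ne_zero (by linarith [M.one_lt_γ])
  have hutility (κ : ℝ) : M.optUtility κ 0 = 0 := by
    rw [optUtility, neg_zero, max_self, zero_div, Real.zero_rpow hexponent]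
  have hcost : 0 ≤ ∫ t in (0 : ℝ)..M.T, M.r * Real.exp (-M.r * t) * M.h (M.optEffortAt 0 t) :=
    intervalIntegral.integral_nonneg M.T.coe_nonneg fun t _ => mul_nonneg
      (mul_nonneg M.r_pos.le (Real.exp_pos _).le) (M.h_nonneg (M.optEffortAt_mem 0 t).1)
  simp only [agentValue, optPlan, zero_mul, hutility, mul_zero, Finset.sum_const_zero, add_zero,
    zero_sub]
  linarith

lemma tendsto_agentValue_optPlan (s : Fin M.N → ℝ) :
    Filter.Tendsto (fun l => M.agentValue (M.optPlan s l)) Filter.atBot Filter.atTop := by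
  have hterminal : Filter.Tendsto (fun l => Real.exp (-M.r * M.T) *
      M.optUtility 0 (l * Real.exp ((M.ρ - M.r) * M.T)) - M.h M.abar) Filter.atBot Filter.atTop :=
    Filter.tendsto_atTop_add_const_right _ _ (((M.tendsto_optUtility_atBot le_rfl).comp
      (Filter.tendsto_id.atBot_mul_const (Real.exp_pos _))).const_mul_atTop (Real.exp_pos _))
  refine Filter.tendsto_atTop_mono (fun l => ?_) hterminal
  have hcost_cont : Continuous fun t => M.h (M.optEffortAt l t) :=
    M.continuous_h_optEffortAt.comp (f := fun t => (l, t)) (by fun_prop)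
  have cost := integral_discounted_le_add M.r_pos.le M.T.coe_nonneg (M.h_nonneg M.abar_pos.le)
    (f := fun t => M.h (M.optEffortAt l t)) (g := fun _ => 0)
    (Continuous.intervalIntegrable (by fun_prop) _ _)
    (Continuous.intervalIntegrable (by fun_prop) _ _) fun t _ => by
      have ha := M.optEffortAt_mem l t
      simpa only [zero_add] using M.h_mono ha.1 M.abar_pos.le ha.2
  have bonuses : 0 ≤ ∑ i, Real.exp (-M.r * s i) * (M.optPlan s l).bonusUtility i :=
    Finset.sum_nonneg fun i _ => mul_nonneg (Real.exp_pos _).le (M.optUtility_nonneg M.k_pos.le _)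
  simp only [mul_zero, intervalIntegral.integral_zero, zero_add] at cost
  simp only [agentValue, optPlan] at bonuses ⊢
  linarith

lemma exists_agentValue_optPlan_eq (s : Fin M.N → ℝ) {v : ℝ} (hv : 0 ≤ v) :
    ∃ l ≤ 0, M.agentValue (M.optPlan s l) = v := by
  obtain ⟨l₀, hl₀, hvl₀⟩ := ((Filter.eventually_le_atBot 0).and
    ((M.tendsto_agentValue_optPlan s).eventually_ge_atTop v)).exists
  obtain ⟨l, hl, hlv⟩ := intermediate_value_Icc' hl₀
    (M.continuous_agentValue_optPlan s).continuousOn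
    ⟨(M.agentValue_optPlan_zero_nonpos s).trans hv, hvl₀⟩
  exact ⟨l, hl.2, hlv⟩

lemma dualInf_le_VFB {R : ℝ} (hR : 0 ≤ R) {s : Fin M.N → ℝ} (hs : Monotone s)
    (hsT : ∀ i, s i ∈ Ico (0 : ℝ) M.T) :
    M.dualInf R (fun l => ∑ i, M.bonus (s i) l) ≤ M.VFB R := by
  obtain ⟨l, hl, hbinding⟩ := M.exists_agentValue_optPlan_eq s (M.u_nonneg hR)
  have hp : M.FeasiblePayments (M.optPlan s l) :=
    { time_mono := hs
      time_mem := hsT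
      bonusUtility_nonneg := fun i => M.optUtility_nonneg M.k_pos.le _
      terminalUtility_nonneg := M.optUtility_nonneg le_rfl _ }
  have heffort : Continuous (M.optEffortAt l) :=
    M.continuous_optEffortAt.comp (f := fun t => (l, t)) (by fun_prop)
  calc M.dualInf R (fun l => ∑ i, M.bonus (s i) l)
      ≤ M.dualFun R (∑ i, M.bonus (s i) l) l := iInf₂_le l hl
    _ = M.principalValue (M.optPlan s l) := by
        rw [M.dualFun_eq_optPlan R s hl, hbinding, sub_self, mul_zero, sub_zero]
    _ ≤ M.VFB R := hp.principalValue_le_VFB heffort (M.optEffortAt_mem l) hbinding.ge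

end PAModel

lemma eventually_mul_rpow_lt {p : ℝ} (hp : 1 < p) (A : ℝ) {c : ℝ} (hc : 0 < c) :
    ∀ᶠ x : ℝ in nhdsWithin 0 (Ioi 0), A * x ^ p < c * x := by
  have hcont : Continuous fun x : ℝ => A * x ^ (p - 1) :=
    continuous_const.mul (Real.continuous_rpow_const (by linarith))
  have hzero : A * (0 : ℝ) ^ (p - 1) < c := by
    rwa [Real.zero_rpow (by linarith), mul_zero]
  filter_upwards [nhdsWithin_le_nhds ((hcont.tendsto 0).eventually_lt_const hzero),
    self_mem_nhdsWithin] with x hx hx0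
  have hx0 : 0 < x := hx0
  rwa [Real.rpow_sub_one hx0.ne', ← mul_div_assoc, div_lt_iff₀ hx0] at hx

lemma sum_Icc_one_eq_sum_fin {A : Type*} [AddCommMonoid A] (f : ℕ → A) (n : ℕ) :
    ∑ i ∈ Finset.Icc 1 n, f i = ∑ i : Fin n, f (i + 1) := by
  rw [← Finset.Ico_add_one_right_eq_Icc, Finset.sum_Ico_eq_sum_range, Nat.add_sub_cancel,
    Finset.sum_range]
  simp only [add_comm]

namespace PAModel

variable {Ω : Type*} [m : MeasurableSpace Ω] (M : PAModel Ω)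

lemma nat_mul_bonus_zero (n : ℕ) (l : ℝ) : n * M.bonus 0 l = -(n * M.Fstar M.k l) := by
  simp [bonus]

lemma nat_mul_bonus (n : ℕ) (s l : ℝ) : n * M.bonus s l
    = -(n * Real.exp (-M.ρ * s) * M.Fstar M.k (l * Real.exp ((M.ρ - M.r) * s))) := by
  rw [bonus]
  ring

lemma VFB_le_dualInf_of_one_le (R : ℝ) (h : 1 ≤ M.δ * M.γ) :
    M.VFB R ≤ M.dualInf R (fun l => -(M.N * M.Fstar M.k l)) := by
  simp only [← nat_mul_bonus_zero]
  exact le_iInf₂ fun l hl => M.VFB_le_dualFun hl fun s hs =>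
    M.paymentGain_antitone h M.k_pos.le hl hs.1

lemma VFB_le_dualInf_of_le_one (R : ℝ) (h : M.δ * M.γ ≤ 1) :
    M.VFB R ≤ M.dualInf R (fun l => -(M.N * Real.exp (-M.ρ * M.T) *
      M.Fstar M.k (l * Real.exp ((M.ρ - M.r) * M.T)))) := by
  simp only [← nat_mul_bonus]
  exact le_iInf₂ fun l hl => M.VFB_le_dualFun hl fun s hs =>
    M.paymentGain_monotone h M.k_pos.le hl hs.2

lemma N_pos : (0 : ℝ) < M.N := by exact_mod_cast M.one_le_N

lemma dualInf_early_le_VFB {R : ℝ} (hR : 0 ≤ R) {ζ : ℝ} (hζ : 0 < ζ)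
    (hζT : ζ < (M.T : ℝ) / M.N) :
    M.dualInf R (fun l => ∑ i ∈ Finset.Icc 1 M.N, M.bonus (((i : ℝ) - 1) * ζ) l)
      ≤ M.VFB R := by
  rw [lt_div_iff₀' M.N_pos] at hζT
  have hle := M.dualInf_le_VFB hR (s := fun i => (i : ℕ) * ζ)
    (fun i j hij => mul_le_mul_of_nonneg_right (by exact_mod_cast hij) hζ.le)
    (fun i => ⟨by positivity, lt_of_le_of_lt
      (mul_le_mul_of_nonneg_right (by exact_mod_cast i.2.le) hζ.le) hζT⟩)
  simpa only [sum_Icc_one_eq_sum_fin, Nat.cast_add_one, add_sub_cancel_right] using hle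

lemma dualInf_late_le_VFB {R : ℝ} (hR : 0 ≤ R) {ζ : ℝ} (hζ : 0 < ζ)
    (hζT : ζ < (M.T : ℝ) / M.N) :
    M.dualInf R (fun l => ∑ i ∈ Finset.Icc 1 M.N, M.bonus ((M.T : ℝ) - i * ζ) l)
      ≤ M.VFB R := by
  rw [lt_div_iff₀' M.N_pos] at hζT
  have hle := M.dualInf_le_VFB hR (s := fun i => M.T - ((i.rev + 1 : ℕ) : ℝ) * ζ)
    (fun i j hij => by
      have hrev : (j.rev : ℕ) ≤ i.rev := Fin.rev_le_rev.2 hij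
      dsimp only
      gcongr)
    (fun i => by
      have hle : ((i.rev + 1 : ℕ) : ℝ) * ζ ≤ M.N * ζ :=
        mul_le_mul_of_nonneg_right (by exact_mod_cast i.rev.2) hζ.le
      have hpos : 0 < ((i.rev + 1 : ℕ) : ℝ) * ζ := by positivity
      exact ⟨by linarith, by linarith⟩)
  have hsum (l : ℝ) : ∑ i : Fin M.N, M.bonus (M.T - ((i.rev + 1 : ℕ) : ℝ) * ζ) l
      = ∑ i : Fin M.N, M.bonus (M.T - ((i + 1 : ℕ) : ℝ) * ζ) l :=
    Equiv.sum_comp Fin.revPerm fun i : Fin M.N => M.bonus (M.T - ((i + 1 : ℕ) : ℝ) * ζ) l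
  simpa only [sum_Icc_one_eq_sum_fin, hsum] using hle

lemma dualInf_le_VFB_of_eq_one {R : ℝ} (hR : 0 ≤ R) (h : M.δ * M.γ = 1) :
    M.dualInf R (fun l => -(M.N * Real.exp (-M.ρ * M.T) *
      M.Fstar M.k (l * Real.exp ((M.ρ - M.r) * M.T)))) ≤ M.VFB R := by
  have hdual := M.dualInf_le_VFB hR (s := fun _ => 0) monotone_const
    fun _ => ⟨le_rfl, M.T_pos⟩
  simp only [Finset.sum_const, Finset.card_univ, Fintype.card_fin, nsmul_eq_mul] at hdual
  simp only [← nat_mul_bonus]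
  refine (iInf₂_mono fun l hl => EReal.coe_le_coe ?_).trans hdual
  have hconst : M.bonus 0 l = M.bonus M.T l :=
    le_antisymm (M.paymentGain_monotone h.le M.k_pos.le hl M.T.coe_nonneg)
      (M.paymentGain_antitone h.ge M.k_pos.le hl M.T.coe_nonneg)
  dsimp only
  rw [hconst]

lemma u_zero : M.u 0 = 0 :=
  Real.zero_rpow (one_div_ne_zero M.γ_pos.ne')

lemma exp_neg_mul_T_lt_one {q : ℝ} (hq : 0 < q) : Real.exp (-q * M.T) < 1 := by
  rw [neg_mul, Real.exp_lt_one_iff, neg_lt_zero]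
  exact mul_pos hq M.T_pos

lemma h_pos {a : ℝ} (ha : 0 < a) : 0 < M.h a := by
  have hmid := M.h_strictConvex.2 (mem_Ici.2 le_rfl) (mem_Ici.2 ha.le) ha.ne
    one_half_pos one_half_pos (add_halves 1)
  simp only [smul_eq_mul, mul_zero, zero_add, M.h_zero] at hmid
  linarith [M.h_nonneg (show 0 ≤ 1 / 2 * a by positivity)]

lemma h_le_mul {a : ℝ} (ha : a ∈ Icc 0 M.abar) : M.h a ≤ M.h M.abar / M.abar * a := by
  have hb := M.abar_pos
  have hconv := M.h_strictConvex.convexOn.2 (mem_Ici.2 le_rfl) (mem_Ici.2 hb.le)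
    (sub_nonneg.2 ((div_le_one hb).2 ha.2)) (div_nonneg ha.1 hb.le) (sub_add_cancel 1 _)
  simp only [smul_eq_mul, mul_zero, zero_add, M.h_zero, div_mul_cancel₀ _ hb.ne'] at hconv
  exact hconv.trans_eq (by ring)

/-- The plan of constant effort `a` in which the only payment is terminal and compensates the agent
for a cost of effort `M.h a` paid at time `0`. -/
noncomputable def constPlan (a : ℝ) : DetPlan M.N where
  time _ := 0
  bonusUtility _ := 0
  terminalUtility := Real.exp (M.r * M.T) * M.h a
  effort _ := a

lemma agentValue_constPlan_nonneg {a : ℝ} (ha : 0 ≤ a) : 0 ≤ M.agentValue (M.constPlan a) := by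
  have hcancel : Real.exp (-M.r * M.T) * (Real.exp (M.r * M.T) * M.h a) = M.h a := by
    rw [← mul_assoc, ← Real.exp_add]
    simp
  simp only [agentValue, constPlan, hcancel, intervalIntegral.integral_mul_const,
    integral_discount, mul_zero, Finset.sum_const_zero]
  linarith [mul_nonneg (Real.exp_pos (-M.r * M.T)).le (M.h_nonneg ha)]

lemma principalValue_constPlan (a : ℝ) :
    M.principalValue (M.constPlan a) = (1 - Real.exp (-M.ρ * M.T)) * a
      - Real.exp (-M.ρ * M.T) * (Real.exp (M.r * M.T) * M.h a) ^ M.γ := by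
  simp only [principalValue, constPlan, intervalIntegral.integral_mul_const, integral_discount,
    Real.zero_rpow M.γ_pos.ne', mul_zero, Finset.sum_const_zero]
  ring

lemma exists_principalValue_constPlan_pos :
    ∃ a ∈ Icc 0 M.abar, 0 < M.principalValue (M.constPlan a) := by
  set K := Real.exp (M.r * M.T) * (M.h M.abar / M.abar) with hK
  have hK0 : 0 ≤ K := mul_nonneg (Real.exp_pos _).le
    (div_nonneg (M.h_nonneg M.abar_pos.le) M.abar_pos.le)
  obtain ⟨a, hlt, ha0, hab⟩ := ((eventually_mul_rpow_lt M.one_lt_γ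
    (Real.exp (-M.ρ * M.T) * K ^ M.γ) (sub_pos.2 (M.exp_neg_mul_T_lt_one M.ρ_pos))).and
    (Ioo_mem_nhdsGT M.abar_pos)).exists
  refine ⟨a, ⟨ha0.le, hab.le⟩, ?_⟩
  have hpay : (Real.exp (M.r * M.T) * M.h a) ^ M.γ ≤ K ^ M.γ * a ^ M.γ := by
    rw [← Real.mul_rpow hK0 ha0.le, hK, mul_assoc]
    have := M.h_nonneg ha0.le
    have := M.γ_pos
    gcongr
    exact M.h_le_mul ⟨ha0.le, hab.le⟩
  rw [M.principalValue_constPlan]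
  linarith [mul_le_mul_of_nonneg_left hpay (Real.exp_pos (-M.ρ * M.T)).le]

lemma VFB_zero_pos : 0 < M.VFB 0 := by
  obtain ⟨a, ha, hpos⟩ := M.exists_principalValue_constPlan_pos
  have hp : M.FeasiblePayments (M.constPlan a) :=
    { time_mono := monotone_const
      time_mem := fun _ => ⟨le_rfl, M.T_pos⟩
      bonusUtility_nonneg := fun _ => le_rfl
      terminalUtility_nonneg := mul_nonneg (Real.exp_pos _).le (M.h_nonneg ha.1) }
  exact (EReal.coe_pos.2 hpos).trans_le (hp.principalValue_le_VFB continuous_const (fun _ => ha)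
    (M.u_zero.trans_le (M.agentValue_constPlan_nonneg ha.1)))

lemma Gstar_le {b p : ℝ} (hb : 0 ≤ b) (hp : p ≤ 0) (hbp : -(M.h b * p) ≤ M.abar - b) :
    M.Gstar p ≤ M.abar + M.h b * p := by
  refine csSup_le ((nonempty_Icc.2 M.abar_pos.le).image _) ?_
  rintro _ ⟨a, ha, rfl⟩
  dsimp only
  rcases le_total a b with hab | hba
  · linarith [mul_nonpos_of_nonneg_of_nonpos (M.h_nonneg ha.1) hp]
  · linarith [mul_le_mul_of_nonpos_right (M.h_mono hb ha.1 hba) hp, ha.2]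

lemma effortGain_neg_le {b x t : ℝ} (hb : 0 ≤ b) (hx : 0 ≤ x)
    (hbx : M.h b * (M.δ * x * Real.exp ((M.ρ - M.r) * t)) ≤ M.abar - b) :
    M.effortGain (-x) t
      ≤ M.ρ * Real.exp (-M.ρ * t) * M.abar - x * (M.r * Real.exp (-M.r * t) * M.h b) := by
  have hρ := M.ρ_pos
  have hG := M.Gstar_le hb (M.δ_mul_exp_nonpos (neg_nonpos.2 hx) ((M.ρ - M.r) * t))
    (by linarith)
  calc M.effortGain (-x) t
      ≤ M.ρ * Real.exp (-M.ρ * t)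
          * (M.abar + M.h b * (M.δ * -x * Real.exp ((M.ρ - M.r) * t))) :=
        mul_le_mul_of_nonneg_left hG (by positivity)
    _ = M.ρ * Real.exp (-M.ρ * t) * M.abar - x * (M.r * Real.exp (-M.r * t) * M.h b) := by
        rw [← M.discounted_exp_mul]
        ring

lemma integral_effortGain_neg_le {b x : ℝ} (hb : 0 ≤ b) (hx : 0 ≤ x)
    (hbx : M.h b * (M.δ * x * Real.exp (M.ρ * M.T)) ≤ M.abar - b) :
    ∫ t in (0 : ℝ)..M.T, M.effortGain (-x) t
      ≤ (1 - Real.exp (-M.ρ * M.T)) * M.abar - x * ((1 - Real.exp (-M.r * M.T)) * M.h b) := by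
  rw [← integral_discount, ← integral_discount, ← intervalIntegral.integral_mul_const,
    ← intervalIntegral.integral_mul_const, ← intervalIntegral.integral_const_mul,
    ← intervalIntegral.integral_sub (Continuous.intervalIntegrable (by fun_prop) _ _)
      (Continuous.intervalIntegrable (by fun_prop) _ _)]
  refine intervalIntegral.integral_mono_on M.T.coe_nonneg
    ((M.continuous_effortGain (neg_nonpos.2 hx)).intervalIntegrable _ _)
    (Continuous.intervalIntegrable (by fun_prop) _ _) fun t ht => M.effortGain_neg_le hb hx ?_
  have hexponent : (M.ρ - M.r) * t ≤ M.ρ * M.T := by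
    linarith [mul_le_mul_of_nonneg_left ht.2 M.ρ_pos.le, mul_nonneg M.r_pos.le ht.1]
  have := M.h_nonneg hb
  have := M.δ_pos
  exact le_trans (by gcongr) hbx

lemma bonus_neg_le {x s : ℝ} (hx : 0 ≤ x) (hs : s ∈ Icc (0 : ℝ) M.T) :
    M.bonus s (-x) ≤ M.conjCoeff M.k * x ^ M.γconj * Real.exp (|M.gainRate| * M.T) := by
  have := M.conjCoeff_pos M.k_pos.le
  have hexponent : M.gainRate * s ≤ |M.gainRate| * M.T :=
    mul_le_mul (le_abs_self _) hs.2 hs.1 (abs_nonneg _)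
  calc M.bonus s (-x) = M.conjCoeff M.k * (-(-x)) ^ M.γconj * Real.exp (M.gainRate * s) :=
        M.paymentGain_eq M.k_pos.le s (neg_nonpos.2 hx)
    _ ≤ M.conjCoeff M.k * x ^ M.γconj * Real.exp (|M.gainRate| * M.T) := by
        rw [neg_neg]
        gcongr

lemma exists_VFB_zero_le_of_small {b : ℝ} (hb : 0 ≤ b) :
    ∃ A, ∀ x ≥ 0, M.h b * (M.δ * x * Real.exp (M.ρ * M.T)) ≤ M.abar - b →
      M.VFB 0 ≤ (((1 - Real.exp (-M.ρ * M.T)) * M.abar + A * x ^ M.γconj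
        - (1 - Real.exp (-M.r * M.T)) * M.h b * x : ℝ) : EReal) := by
  refine ⟨M.N * (M.conjCoeff M.k * Real.exp (|M.gainRate| * M.T))
    + M.conjCoeff 0 * Real.exp (M.gainRate * M.T), fun x hx hbx => ?_⟩
  refine (M.VFB_le_dualFun (neg_nonpos.2 hx) fun s hs => M.bonus_neg_le hx hs).trans
    (EReal.coe_le_coe ?_)
  have hterminal := M.paymentGain_eq le_rfl M.T (neg_nonpos.2 hx)
  have heffort := M.integral_effortGain_neg_le hb hx hbx
  rw [dualFun, hterminal, M.u_zero, neg_neg]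
  linarith

lemma VFB_zero_lt :
    M.VFB 0 < ((M.abar * (1 - Real.exp (-M.ρ * M.T)) : ℝ) : EReal) := by
  have hb := half_pos M.abar_pos
  have hgain : 0 < (1 - Real.exp (-M.r * M.T)) * M.h (M.abar / 2) :=
    mul_pos (sub_pos.2 (M.exp_neg_mul_T_lt_one M.r_pos)) (M.h_pos hb)
  obtain ⟨A, hA⟩ := M.exists_VFB_zero_le_of_small hb.le
  have hsmall : ∀ᶠ x in nhdsWithin 0 (Ioi 0),
      M.h (M.abar / 2) * (M.δ * x * Real.exp (M.ρ * M.T)) < M.abar - M.abar / 2 :=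
    nhdsWithin_le_nhds (((by fun_prop : Continuous fun x =>
      M.h (M.abar / 2) * (M.δ * x * Real.exp (M.ρ * M.T))).tendsto 0).eventually_lt_const
      (by simpa using M.abar_pos))
  obtain ⟨x, hlt, hx, (hx0 : 0 < x)⟩ := ((eventually_mul_rpow_lt M.one_lt_γconj A hgain).and
    (hsmall.and self_mem_nhdsWithin)).exists
  exact (hA x hx0.le hx.le).trans_lt (EReal.coe_lt_coe (by linarith))

end PAModel

theorem mainTheorem1 {Ω : Type*} [MeasurableSpace Ω] (M : PAModel Ω) (R : ℝ) (hR : 0 ≤ R) :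
    (1 < M.δ * M.γ →
      (∀ ζ : ℝ, 0 < ζ → ζ < (M.T : ℝ) / M.N →
        M.dualInf R (fun l => ∑ i ∈ Finset.Icc 1 M.N, M.bonus (((i : ℝ) - 1) * ζ) l)
          ≤ M.VFB R) ∧
      M.VFB R ≤ M.dualInf R (fun l => -(M.N * M.Fstar M.k l))) ∧
    (M.δ * M.γ < 1 →
      (∀ ζ : ℝ, 0 < ζ → ζ < (M.T : ℝ) / M.N →
        M.dualInf R (fun l => ∑ i ∈ Finset.Icc 1 M.N, M.bonus ((M.T : ℝ) - i * ζ) l)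
          ≤ M.VFB R) ∧
      M.VFB R ≤ M.dualInf R (fun l =>
        -(M.N * Real.exp (-M.ρ * M.T) *
          M.Fstar M.k (l * Real.exp ((M.ρ - M.r) * M.T))))) ∧
    (M.δ * M.γ = 1 →
      M.VFB R = M.dualInf R (fun l =>
        -(M.N * Real.exp (-M.ρ * M.T) *
          M.Fstar M.k (l * Real.exp ((M.ρ - M.r) * M.T))))) ∧
    (R = 0 →
      0 < M.VFB R ∧ M.VFB R < ((M.abar * (1 - Real.exp (-M.ρ * M.T)) : ℝ) : EReal)) := by
  refine ⟨fun h => ⟨fun ζ hζ hζT => M.dualInf_early_le_VFB hR hζ hζT,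
      M.VFB_le_dualInf_of_one_le R h.le⟩,
    fun h => ⟨fun ζ hζ hζT => M.dualInf_late_le_VFB hR hζ hζT, M.VFB_le_dualInf_of_le_one R h.le⟩,
    fun h => le_antisymm (M.VFB_le_dualInf_of_le_one R h.le) (M.dualInf_le_VFB_of_eq_one hR h),
    ?_⟩
  rintro rfl
  exact ⟨M.VFB_zero_pos, M.VFB_zero_lt⟩
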